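/- Write $[n]=\{1,\dots,n\}$ and identify distributions on $[n]$ with their probability mass functions. For $k\ge 1$, a $k$-segmentation of $[n]$ consists of $k$ disjoint, possibly empty, intervals $I_1,\dots,I_k$ covering $[n]$; a function on $[n]$ is $k$-flat (on that segmentation) if it is constant on each $I_i$, and a $k$-flat distribution is a distribution that is a $k$-flat function. Two functions are $\epsilon$-close if their $\ell_1$-distance is less than $\epsilon$, and $\epsilon$-far otherwise. Let $q$ be a known distribution on $[n]$, $k\ge 1$ and $0<\epsilon\le 2$. Given independent samples from an unknown distribution $p$ on $[n]$, consider the following algorithm, with absolute constants $C_1,C_2>0$. 1. Put $\epsilon'=\epsilon/14$, $\eta=\epsilon'/4$, $v=\lceil \log(n/\eta^2)/\log(1+\eta)\rceil+1$, $t=kv$. The buckets are $B_1=\{x: q(x)\le \eta^2/n\}$ and $B_j=\{x:(1+\eta)^{j-2}\eta^2/n<q(x)\le(1+\eta)^{j-1}\eta^2/n\}$ for $2\le j\le v$. 2. Draw $s=Rm$ samples, in $R=\lceil C_1\log(4n/\epsilon)\rceil$ batches of $m=\lceil C_2\sqrt{nt}/\epsilon^3\rceil$; let $\hat p$ be the empirical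 distribution of all $s$ samples. 3. For every $k$-segmentation $I_1,\dots,I_k$: let $\mathcal D$ be the partition of $[n]$ into the sets $I_i\cap B_j$, where each such set of size $z>\lceil n/t\rceil$ is further split into $\lfloor zt/n\rfloor+1$ runs of consecutive elements of the set, of roughly equal size (the element preceded by exactly $a$ elements of the set goes to run number $\lfloor aL/z\rfloor$, where $L=\lfloor zt/n\rfloor+1$). The segmentation passes if both of the following hold. (a) For every $D\in\mathcal D$ that contains at least $\epsilon' s/(4t)$ of the samples, at most half of the batches have a collision estimate at least $(2\epsilon')^2/|D|$. Here the collision estimate of a batch is the fraction of coinciding pairs among all pairs of its samples that lie in $D$ (read as $0$ if there is no pair), minus $1/|D|$; it estimates the squared $\ell_2$-distance between $p$ conditioned on $D$ and the uniform distribution on $D$. (b) For some $\alpha\in\{0,\epsilon'/2,\epsilon',\dots,1\}$ there is a nonnegative function $f$, constant on each $I_i$, such that $\sum_{D\in\mathcal D}|\hat p(D)-(1-\alpha)q(D)-\alpha f(D)|<2\epsilon'$. 4. Accept if some $k$-segmentation passes; otherwise reject. Theorem. There are absolute constants $C_1,C_2,C>0$ and $c\in\mathbb N$ such that, for all $n$,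 $k\ge1$, $0<\epsilon\le2$ and all distributions $q$ on $[n]$, this algorithm is an identity tester in the presence of $k$-flat noise: for every distribution $p$ on $[n]$, - if $p=(1-\alpha)q+\alpha r$ for some $\alpha\in[0,1]$ and some $k$-flat distribution $r$, then it accepts with probability at least $2/3$; - if $p$ is $\epsilon$-far from $(1-\alpha)q+\alpha r$ for every $\alpha\in[0,1]$ and every $k$-flat distribution $r$, then it rejects with probability at least $2/3$; and the number $s$ of samples that it uses is $\widetilde O(\sqrt{nk}/\epsilon^{3.5})$, namely $$ s\le C\,\frac{\sqrt{nk}}{\epsilon^{3.5}}\,\bigl(\log(4n/\epsilon)\bigr)^{c}. $$ -/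

import Mathlib

noncomputable section

open scoped Classical

namespace KFlat

/-! ### The testing problem -/

/-- A `k`-segmentation of `[n]`: `k` pairwise disjoint (possibly empty) intervals that cover
`[n]`. -/
structure Segmentation (n k : ℕ) where
  part : Fin k → Finset (Fin n)
  ordConnected : ∀ i, Set.OrdConnected (part i : Set (Fin n))
  disjoint : ∀ i j, i ≠ j → Disjoint (part i) (part j)
  cover : ∀ x, ∃ i, x ∈ part i

/-- `f` is constant on every interval of the segmentation `I`. -/
def Segmentation.IsFlatOn {n k : ℕ} (I : Segmentation n k) (f : Fin n → ℝ) : Prop :=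
  ∀ i, ∀ x ∈ I.part i, ∀ y ∈ I.part i, f x = f y

/-- `k`-flat functions on `[n]`. -/
def IsFlat {n : ℕ} (k : ℕ) (f : Fin n → ℝ) : Prop :=
  ∃ I : Segmentation n k, I.IsFlatOn f

/-- `r` is (the probability mass function of) a `k`-flat distribution. -/
def IsFlatDist {n : ℕ} (k : ℕ) (r : Fin n → ℝ) : Prop :=
  r ∈ stdSimplex ℝ (Fin n) ∧ IsFlat k r

/-- The mixture `(1 - α) q + α r`. -/
def mixture {n : ℕ} (α : ℝ) (q r : Fin n → ℝ) : Fin n → ℝ :=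
  fun x => (1 - α) * q x + α * r x

/-- The `ℓ₁`-distance. -/
def l1Dist {n : ℕ} (f g : Fin n → ℝ) : ℝ := ∑ x, |f x - g x|

/-- `p` is a mixture of `q` and some `k`-flat distribution. -/
def IsMixtureWithFlat {n : ℕ} (k : ℕ) (q p : Fin n → ℝ) : Prop :=
  ∃ r, IsFlatDist k r ∧ ∃ α ∈ Set.Icc (0 : ℝ) 1, p = mixture α q r

/-- `p` is `ε`-far from every mixture of `q` and a `k`-flat distribution. -/
def IsFarFromMixtures {n : ℕ} (k : ℕ) (ε : ℝ) (q p : Fin n → ℝ) : Prop :=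
  ∀ r, IsFlatDist k r → ∀ α ∈ Set.Icc (0 : ℝ) 1, ε ≤ l1Dist p (mixture α q r)

/-- The probability of the event `E` when `s` independent samples are drawn from `p`. -/
def sampleProb {n : ℕ} (p : Fin n → ℝ) (s : ℕ) (E : (Fin s → Fin n) → Prop) : ℝ :=
  ∑ x : Fin s → Fin n, if E x then ∏ i, p (x i) else 0

/-- The decision rule `accept`, applied to `s` independent samples of an unknown distribution,
is an identity tester for `q` in the presence of `k`-flat noise with proximity parameter `ε`. -/
def IsFlatNoiseIdentityTester {n : ℕ} (k : ℕ) (ε : ℝ) (q : Fin n → ℝ) (s : ℕ)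
    (accept : (Fin s → Fin n) → Prop) : Prop :=
  ∀ p ∈ stdSimplex ℝ (Fin n),
    (IsMixtureWithFlat k q p → 2 / 3 ≤ sampleProb p s accept) ∧
    (IsFarFromMixtures k ε q p → 2 / 3 ≤ sampleProb p s fun x => ¬ accept x)

/-! ### Partitions of the domain -/

/-- The number `v` of buckets: `(1 + η) ^ (v - 1) * η ^ 2 / n ≥ 1`, so that every value
`q x ≤ 1` falls into one of the `v` buckets. -/
def numBuckets (n : ℕ) (η : ℝ) : ℕ :=
  ⌈Real.log (n / η ^ 2) / Real.log (1 + η)⌉₊ + 1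

/-- The buckets of `[n]` with respect to `q`, numbered from `0`. -/
def bucket {n : ℕ} (q : Fin n → ℝ) (η : ℝ) : ℕ → Finset (Fin n)
  | 0 => {x | q x ≤ η ^ 2 / n}
  | j + 1 => {x | (1 + η) ^ j * η ^ 2 / n < q x ∧ q x ≤ (1 + η) ^ (j + 1) * η ^ 2 / n}

/-- The number of pieces into which a set of size `z` is split. -/
def numPieces (n t z : ℕ) : ℕ :=
  if ⌈(n : ℝ) / t⌉₊ < z then z * t / n + 1 else 1

/-- The `l`-th piece of `S`, when `S` is split into `numPieces n t S.card` runs of consecutive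
elements of `S` of roughly the same size: the element of rank `a` in `S` goes to the piece
`⌊a * numPieces n t S.card / S.card⌋`. -/
def piece {n : ℕ} (t : ℕ) (S : Finset (Fin n)) (l : ℕ) : Finset (Fin n) :=
  {x ∈ S | (Finset.card {y ∈ S | y < x}) * numPieces n t S.card / S.card = l}

/-- The refined division: every intersection of an interval of `I` with a bucket is split into
pieces of size at most `⌈n / t⌉`, where `t = k * v` and `v` is the number of buckets. -/
def refinedDivision {n k : ℕ} (I : Segmentation n k) (q : Fin n → ℝ) (η : ℝ) :
    Finset (Finset (Fin n)) :=
  Finset.univ.biUnion fun i : Fin k =>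
    (Finset.range (numBuckets n η)).biUnion fun j =>
      (Finset.range (numPieces n (k * numBuckets n η) (I.part i ∩ bucket q η j).card)).image
        (piece (k * numBuckets n η) (I.part i ∩ bucket q η j))

/-- The `ℓ₁`-distance between the coarsenings of `f` and `g` over the sets in `𝒟`. -/
def coarseDist {n : ℕ} (𝒟 : Finset (Finset (Fin n))) (f g : Fin n → ℝ) : ℝ :=
  ∑ D ∈ 𝒟, |(∑ x ∈ D, f x) - (∑ x ∈ D, g x)|

/-! ### The algorithm -/

/-- The number of samples that fall into `D`. -/
def countIn {n s : ℕ} (x : Fin s → Fin n) (D : Finset (Fin n)) : ℕ :=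
  Finset.card {i : Fin s | x i ∈ D}

/-- The empirical distribution of the samples `x`. -/
def empirical {n s : ℕ} (x : Fin s → Fin n) : Fin n → ℝ :=
  fun a => (countIn x {a} : ℝ) / s

/-- The number of pairs of samples in `D` that coincide. -/
def collisions {n m : ℕ} (y : Fin m → Fin n) (D : Finset (Fin n)) : ℕ :=
  Finset.card {ij : Fin m × Fin m | ij.1 < ij.2 ∧ y ij.1 = y ij.2 ∧ y ij.1 ∈ D}

/-- The collision estimate of the squared `ℓ₂`-distance, on `D`, between the conditional
distribution of the samples in `D` and the uniform distribution: the fraction of colliding pairs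
(read as `0` if there are no pairs) minus `1 / |D|`. -/
def l2SqEstimate {n m : ℕ} (y : Fin m → Fin n) (D : Finset (Fin n)) : ℝ :=
  (collisions y D : ℝ) / ((countIn y D).choose 2 : ℝ) - 1 / (D.card : ℝ)

/-- The `b`-th of `R` batches of `m` samples each. -/
def batch {n R m : ℕ} (x : Fin (R * m) → Fin n) (b : Fin R) : Fin m → Fin n :=
  fun i => x (finProdFinEquiv (b, i))

/-- In more than half of the batches, the estimated `ℓ₂`-distance to uniform on `D` is at least
`2 ε' / √|D|`. -/
def LooksNonuniform {n R m : ℕ} (ε' : ℝ) (x : Fin (R * m) → Fin n) (D : Finset (Fin n)) : Prop :=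
  R < 2 * Finset.card {b : Fin R | (2 * ε') ^ 2 / (D.card : ℝ) ≤ l2SqEstimate (batch x b) D}

/-- The mixture parameters `0, ε'/2, ε', …, 1` that are tried. -/
def alphaGrid (ε' : ℝ) : Set ℝ :=
  insert 1 {α | α ≤ 1 ∧ ∃ i : ℕ, α = i * (ε' / 2)}

/-- The acceptance condition of the tester on the samples `x`, which consist of `R` batches of `m`
samples each. Some segmentation has to pass both the uniformity tests on the sets of the
refined division and the test of the overall shape. -/
def Accepts {n : ℕ} (k : ℕ) (ε : ℝ) (q : Fin n → ℝ) (R m : ℕ) (x : Fin (R * m) → Fin n) : Prop :=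
  let ε' := ε / 14
  let η := ε' / 4
  let t := k * numBuckets n η
  ∃ I : Segmentation n k,
    (∀ D ∈ refinedDivision I q η,
      ε' * ((R * m : ℕ) : ℝ) / (4 * (t : ℝ)) ≤ (countIn x D : ℝ) → ¬ LooksNonuniform ε' x D) ∧
    ∃ α ∈ alphaGrid ε', ∃ f : Fin n → ℝ, (∀ a, 0 ≤ f a) ∧ I.IsFlatOn f ∧
      coarseDist (refinedDivision I q η) (empirical x) (mixture α q f) < 2 * ε'

/-- The number of batches, `Θ(log (n / ε))`. -/
def numBatches (C : ℝ) (n : ℕ) (ε : ℝ) : ℕ := ⌈C * Real.log (4 * n / ε)⌉₊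

/-- The number of samples in a batch, `Θ(√(n t) / ε ^ 3)` with `t = k * v`. -/
def batchSize (C : ℝ) (n k : ℕ) (ε : ℝ) : ℕ :=
  ⌈C * √((n : ℝ) * ((k * numBuckets n (ε / 14 / 4) : ℕ) : ℝ)) / ε ^ 3⌉₊

end KFlat

end

/-! Write ε' = ε/14 and t = kv. If r is flat on I₁, …, I_k, then a mixture of q and r is almost
uniform on every set D of the division that is not too light: r is constant there, and q varies by a
factor of at most 1 + η, or additively by at most η²/n in the lowest bucket. Conversely, if p is
almost uniform on the heavy sets D, then p is determined up to O(ε') in ℓ₁ by the masses p(D). It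
then suffices to compare these masses with those of a mixture, which is test (b).

Uniformity on one set. After clearing denominators, the collision test asks for the sign of the sum
over pairs of samples of the kernel 1[a = b ∈ D] - θ 1[a, b ∈ D], where θ = (1 + 4ε'²)/|D|. Its mean
per pair is V - 4ε'² p(D)²/|D|, where V is the squared ℓ₂-deviation of p from its average on D.
Hoeffding's decomposition bounds the variance (`expect_sq_pairSum_sub_mean_le`), and Chebyshev's
inequality gives the right sign with probability at least 35/36, both for V ≤ ε'² p(D)²/|D| and for
V ≥ 9ε'² p(D)²/|D|, provided that m p(D) ε'² is a large multiple of √|D|. Since |D| ≤ 2n/t for a set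
with at least two elements, m of order √(nt)/ε³ suffices for masses of order ε'/t. The majority over
R batches makes the error exponentially small in R.

All segmentations at once. There may be about n^k segmentations, but every nonempty set of every
division is a `run`, determined by its least and greatest element (`exists_eq_run`). So only n² sets
need uniformity tests, and an error (4n/ε)^(-10) per set is affordable. For test (b), the empirical
masses are close to those of p on all divisions if no union of at most N = min(n, 2t) runs is
overrepresented (`coarseDist_le_of_countIn_lt`). There are at most (n² + 1)^N such unions, which an
additive Chernoff bound absorbs because N = O(√(nt)).

`completeness` applies this to the segmentation of r. `soundness` shows that any passing
segmentation would yield a mixture at distance less than ε from p. The sample bound follows from v =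
O(log(n/ε)/ε): the root of v contributes the last half power of 1/ε. -/

noncomputable section

open scoped Classical

namespace KFlat

/-! ### Independent samples from a finite distribution -/

section Expectation

variable {ι α : Type*} [Fintype ι] [DecidableEq ι] [Fintype α]

/-- The expectation of `F` over a family of independent samples of `p`, indexed by `ι`. -/
def expect (p : α → ℝ) (F : (ι → α) → ℝ) : ℝ := ∑ x, (∏ i, p (x i)) * F x

/-- The probability of the event `E` over independent samples of `p`, indexed by `ι`. -/
def prob (p : α → ℝ) (E : (ι → α) → Prop) : ℝ := expect p fun x => if E x then 1 else 0

lemma expect_add (p : α → ℝ) (F G : (ι → α) → ℝ) :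
    expect p (fun x => F x + G x) = expect p F + expect p G := by
  simp [expect, mul_add, Finset.sum_add_distrib]

lemma expect_const_mul (p : α → ℝ) (c : ℝ) (F : (ι → α) → ℝ) :
    expect p (fun x => c * F x) = c * expect p F := by
  simp only [expect, Finset.mul_sum]
  exact Finset.sum_congr rfl fun x _ => by ring

lemma expect_sum {κ : Type*} (p : α → ℝ) (s : Finset κ) (F : κ → (ι → α) → ℝ) :
    expect p (fun x => ∑ j ∈ s, F j x) = ∑ j ∈ s, expect p (F j) := by
  simp only [expect, Finset.mul_sum]
  exact Finset.sum_comm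

lemma expect_mono {p : α → ℝ} (hp : ∀ a, 0 ≤ p a) {F G : (ι → α) → ℝ} (h : ∀ x, F x ≤ G x) :
    expect p F ≤ expect p G :=
  Finset.sum_le_sum fun x _ =>
    mul_le_mul_of_nonneg_left (h x) (Finset.prod_nonneg fun i _ => hp (x i))

/-- Independence of the samples. All moment generating functions below are computed from this
identity. -/
lemma expect_prod (p : α → ℝ) (f : ι → α → ℝ) :
    expect p (fun x => ∏ i, f i (x i)) = ∏ i, ∑ a, p a * f i a := by
  rw [Finset.prod_univ_sum, Fintype.piFinset_univ]
  simp [expect, Finset.prod_mul_distrib]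

lemma expect_const {p : α → ℝ} (hp : p ∈ stdSimplex ℝ α) (c : ℝ) :
    expect p (fun _ : ι → α => c) = c := by
  have h := expect_prod p (fun (_ : ι) _ => (1 : ℝ))
  simp only [Finset.prod_const_one, mul_one, hp.2] at h
  have h2 := expect_const_mul p c (fun _ : ι → α => (1 : ℝ))
  rw [h] at h2
  simpa using h2

/-- Markov's inequality. -/
lemma prob_le_expect {p : α → ℝ} (hp : p ∈ stdSimplex ℝ α) {E : (ι → α) → Prop}
    {F : (ι → α) → ℝ} (hF : ∀ x, 0 ≤ F x) (hE : ∀ x, E x → 1 ≤ F x) : prob p E ≤ expect p F :=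
  expect_mono hp.1 fun x => by
    split_ifs with h
    · exact hE x h
    · exact hF x

lemma prob_mono {p : α → ℝ} (hp : p ∈ stdSimplex ℝ α) {E E' : (ι → α) → Prop}
    (h : ∀ x, E x → E' x) : prob p E ≤ prob p E' :=
  prob_le_expect hp (fun x => by split_ifs <;> norm_num) fun x hx => by simp [h x hx]

lemma prob_not {p : α → ℝ} (hp : p ∈ stdSimplex ℝ α) (E : (ι → α) → Prop) :
    prob p (fun x => ¬ E x) = 1 - prob p E := by
  rw [eq_sub_iff_add_eq, prob, prob, ← expect_add]
  refine Eq.trans ?_ (expect_const hp (ι := ι) 1)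
  congr 1
  ext x
  by_cases h : E x <;> simp [h]

lemma prob_or_le {p : α → ℝ} (hp : p ∈ stdSimplex ℝ α) (E E' : (ι → α) → Prop) :
    prob p (fun x => E x ∨ E' x) ≤ prob p E + prob p E' := by
  rw [prob, prob, prob, ← expect_add]
  refine expect_mono hp.1 fun x => ?_
  by_cases h : E x <;> by_cases h' : E' x <;> simp [h, h']

/-- The union bound. -/
lemma prob_exists_le {κ : Type*} [Fintype κ] {p : α → ℝ} (hp : p ∈ stdSimplex ℝ α)
    (E : κ → (ι → α) → Prop) {b : ℝ} (hb : ∀ j, prob p (E j) ≤ b) :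
    prob p (fun x => ∃ j, E j x) ≤ Fintype.card κ * b := by
  calc prob p (fun x => ∃ j, E j x)
      ≤ expect p (fun x => ∑ j, if E j x then (1 : ℝ) else 0) := by
        refine prob_le_expect hp
          (fun x => Finset.sum_nonneg fun j _ => by split_ifs <;> norm_num) ?_
        rintro x ⟨j, hj⟩
        refine le_trans ?_ (Finset.single_le_sum (f := fun j => if E j x then (1 : ℝ) else 0)
          (fun j _ => by split_ifs <;> norm_num) (Finset.mem_univ j))
        simp [hj]
    _ = ∑ j, prob p (E j) := expect_sum _ _ _
    _ ≤ ∑ _j : κ, b := Finset.sum_le_sum fun j _ => hb j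
    _ = Fintype.card κ * b := by simp

lemma prod_mem_stdSimplex {p : α → ℝ} (hp : p ∈ stdSimplex ℝ α) :
    (fun y : ι → α => ∏ i, p (y i)) ∈ stdSimplex ℝ (ι → α) :=
  ⟨fun y => Finset.prod_nonneg fun i _ => hp.1 (y i), by
    simpa [expect] using expect_const hp (ι := ι) 1⟩

lemma sum_ite_eq_prob (p : α → ℝ) (E : (ι → α) → Prop) :
    (∑ y, if E y then ∏ i, p (y i) else 0) = prob p E :=
  Finset.sum_congr rfl fun y _ => by by_cases h : E y <;> simp [h]

end Expectation

lemma sampleProb_eq_prob {n s : ℕ} (p : Fin n → ℝ) (E : (Fin s → Fin n) → Prop) :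
    sampleProb p s E = prob p E :=
  sum_ite_eq_prob p E

/-- Drawing `m + 1` samples amounts to drawing one sample and then `m` more. -/
lemma expect_succ {α : Type*} [Fintype α] (p : α → ℝ) {m : ℕ} (F : (Fin (m + 1) → α) → ℝ) :
    expect p F = ∑ a, p a * expect p fun y : Fin m → α => F (Fin.cons a y) := by
  simp only [expect, Finset.mul_sum]
  rw [← (Fin.consEquiv fun _ : Fin (m + 1) => α).sum_comp, Fintype.sum_prod_type]
  refine Finset.sum_congr rfl fun a _ => Finset.sum_congr rfl fun y _ => ?_
  simp [Fin.consEquiv, Fin.prod_univ_succ, mul_assoc]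

/-- The batches are independent families of independent samples. -/
lemma prob_batch {n R m : ℕ} (p : Fin n → ℝ) (E : (Fin R → Fin m → Fin n) → Prop) :
    prob p (fun x : Fin (R * m) → Fin n => E (batch x)) =
      prob (fun y : Fin m → Fin n => ∏ i, p (y i)) E := by
  let e : (Fin (R * m) → Fin n) ≃ (Fin R → Fin m → Fin n) :=
    (finProdFinEquiv.symm.arrowCongr (Equiv.refl _)).trans (Equiv.curry _ _ _)
  have he : ∀ x, e x = batch x := fun x => by
    ext b i
    simp [e, batch, Equiv.arrowCongr, Function.curry]
  rw [prob, prob, expect, expect, ← e.sum_comp]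
  refine Finset.sum_congr rfl fun x _ => ?_
  rw [he]
  congr 1
  rw [← finProdFinEquiv.prod_comp, Fintype.prod_prod_type]
  rfl

/-! ### Concentration -/

section Concentration

variable {ι α : Type*} [Fintype ι] [DecidableEq ι] [Fintype α]

lemma sum_mem_Icc_of_mem_stdSimplex {p : α → ℝ} (hp : p ∈ stdSimplex ℝ α) (A : Finset α) :
    ∑ a ∈ A, p a ∈ Set.Icc (0 : ℝ) 1 :=
  ⟨Finset.sum_nonneg fun a _ => hp.1 a, by
    rw [← hp.2]
    exact Finset.sum_le_sum_of_subset_of_nonneg (Finset.subset_univ _) fun a _ _ => hp.1 a⟩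

lemma prod_ite_eq_pow_card {ι α : Type*} [Fintype ι] [DecidableEq α] (x : ι → α) (A : Finset α) (w : ℝ) :
    (∏ i, if x i ∈ A then w else 1) = w ^ Finset.card {i | x i ∈ A} := by
  rw [Finset.prod_ite]
  simp

/-- The generating function of the number of samples in `A`. -/
lemma expect_pow_card [DecidableEq α] {p : α → ℝ} (hp : p ∈ stdSimplex ℝ α) (A : Finset α) (w : ℝ) :
    expect p (fun x : ι → α => w ^ Finset.card {i | x i ∈ A}) =
      (1 + (w - 1) * ∑ a ∈ A, p a) ^ Fintype.card ι := by
  have h : ∑ a, p a * (if a ∈ A then w else 1) = 1 + (w - 1) * ∑ a ∈ A, p a := by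
    have h1 : ∀ a, p a * (if a ∈ A then w else 1) = p a + (w - 1) * (if a ∈ A then p a else 0) := by
      intro a
      split_ifs <;> ring
    simp_rw [h1]
    rw [Finset.sum_add_distrib, hp.2, ← Finset.mul_sum, Finset.sum_ite_mem, Finset.univ_inter]
  simp_rw [← prod_ite_eq_pow_card]
  rw [expect_prod p (fun _ a => if a ∈ A then w else 1), h]
  simp

/-- If each sample lies in `A` with probability at most `1 / 36`, then it is exponentially
unlikely that at least half of the samples do. -/
lemma prob_half_le [DecidableEq α] {p : α → ℝ} (hp : p ∈ stdSimplex ℝ α) {A : Finset α}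
    (hA : ∑ a ∈ A, p a ≤ 1 / 36) :
    prob p (fun x : ι → α => Fintype.card ι ≤ 2 * Finset.card {i | x i ∈ A}) ≤
      (1 / 3 : ℝ) ^ Fintype.card ι := by
  calc prob p (fun x : ι → α => Fintype.card ι ≤ 2 * Finset.card {i | x i ∈ A})
      -- Markov's inequality with weight 36 per sample in `A`: the base is then at most 1 + 35/36 ≤
      -- 2, and 2/6 = 1/3.
      ≤ expect p (fun x : ι → α => (1 / 6 : ℝ) ^ Fintype.card ι *
          36 ^ Finset.card {i | x i ∈ A}) := by
        refine prob_le_expect hp (fun x => by positivity) fun x hx => ?_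
        have h : (6 : ℝ) ^ Fintype.card ι ≤ 36 ^ Finset.card {i | x i ∈ A} := by
          calc (6 : ℝ) ^ Fintype.card ι ≤ 6 ^ (2 * Finset.card {i | x i ∈ A}) :=
                pow_le_pow_right₀ (by norm_num) hx
            _ = 36 ^ Finset.card {i | x i ∈ A} := by rw [pow_mul]; norm_num
        calc (1 : ℝ) = (1 / 6) ^ Fintype.card ι * 6 ^ Fintype.card ι := by
              rw [← mul_pow]; norm_num
          _ ≤ _ := mul_le_mul_of_nonneg_left h (by positivity)
    _ = (1 / 6 : ℝ) ^ Fintype.card ι * (1 + (36 - 1) * ∑ a ∈ A, p a) ^ Fintype.card ι := by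
        rw [expect_const_mul, expect_pow_card hp]
    _ ≤ (1 / 6 : ℝ) ^ Fintype.card ι * 2 ^ Fintype.card ι := by
        have := (sum_mem_Icc_of_mem_stdSimplex hp A).1
        gcongr
        linarith
    _ = (1 / 3 : ℝ) ^ Fintype.card ι := by
        rw [← mul_pow]; norm_num

lemma one_add_pow_le_exp {x : ℝ} (hx : 0 ≤ 1 + x) (N : ℕ) : (1 + x) ^ N ≤ Real.exp (N * x) := by
  rw [Real.exp_nat_mul]
  refine pow_le_pow_left₀ hx ?_ N
  linarith [Real.add_one_le_exp x]

end Concentration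

/-- Chernoff bound with weight 2 per sample in `D`; the exponent is a/2 - a log 2, and log 2 > 2/3.
-/
lemma prob_le_countIn {n s : ℕ} {p : Fin n → ℝ} (hp : p ∈ stdSimplex ℝ (Fin n))
    (D : Finset (Fin n)) {a : ℝ} (ha : s * ∑ x ∈ D, p x ≤ a / 2) :
    prob p (fun x : Fin s → Fin n => a ≤ countIn x D) ≤ Real.exp (-a / 6) := by
  have hP := (sum_mem_Icc_of_mem_stdSimplex hp D).1
  have hl := Real.log_two_gt_d9
  have ha0 : 0 ≤ a := by
    have : 0 ≤ s * ∑ x ∈ D, p x := by positivity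
    linarith
  calc prob p (fun x : Fin s → Fin n => a ≤ countIn x D)
      ≤ expect p (fun x : Fin s → Fin n => Real.exp (-(a * Real.log 2)) *
          2 ^ Finset.card {i | x i ∈ D}) := by
        refine prob_le_expect hp (fun x => by positivity) fun x hx => ?_
        have h2 : (2 : ℝ) ^ Finset.card {i | x i ∈ D} = Real.exp (countIn x D * Real.log 2) := by
          rw [Real.exp_nat_mul, Real.exp_log (by norm_num)]
          rfl
        rw [h2, ← Real.exp_add]
        apply Real.one_le_exp
        nlinarith
    _ = Real.exp (-(a * Real.log 2)) * (1 + ∑ x ∈ D, p x) ^ s := by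
        rw [expect_const_mul, expect_pow_card hp]
        norm_num
    _ ≤ Real.exp (-(a * Real.log 2)) * Real.exp (s * ∑ x ∈ D, p x) := by
        gcongr
        exact one_add_pow_le_exp (by linarith) s
    _ ≤ Real.exp (-a / 6) := by
        rw [← Real.exp_add]
        apply Real.exp_le_exp.mpr
        nlinarith

/-- The lower tail, with weight 1/2 per sample in `D`; the exponent is (a/4) log 2 - a/2. -/
lemma prob_countIn_lt {n s : ℕ} {p : Fin n → ℝ} (hp : p ∈ stdSimplex ℝ (Fin n))
    (D : Finset (Fin n)) {a : ℝ} (ha0 : 0 ≤ a) (ha : a ≤ s * ∑ x ∈ D, p x) :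
    prob p (fun x : Fin s → Fin n => (countIn x D : ℝ) < a / 4) ≤ Real.exp (-a / 6) := by
  have hP := sum_mem_Icc_of_mem_stdSimplex hp D
  have hl := Real.log_two_gt_d9
  have hl' := Real.log_two_lt_d9
  calc prob p (fun x : Fin s → Fin n => (countIn x D : ℝ) < a / 4)
      ≤ expect p (fun x : Fin s → Fin n => Real.exp (a / 4 * Real.log 2) *
          (1 / 2) ^ Finset.card {i | x i ∈ D}) := by
        refine prob_le_expect hp (fun x => by positivity) fun x hx => ?_
        have h2 : (1 / 2 : ℝ) ^ Finset.card {i | x i ∈ D} =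
            Real.exp (countIn x D * -Real.log 2) := by
          rw [Real.exp_nat_mul, Real.exp_neg, Real.exp_log (by norm_num), one_div]
          rfl
        rw [h2, ← Real.exp_add]
        apply Real.one_le_exp
        nlinarith
    _ = Real.exp (a / 4 * Real.log 2) * (1 + -(1 / 2) * ∑ x ∈ D, p x) ^ s := by
        rw [expect_const_mul, expect_pow_card hp]
        norm_num
    _ ≤ Real.exp (a / 4 * Real.log 2) * Real.exp (s * (-(1 / 2) * ∑ x ∈ D, p x)) := by
        gcongr
        exact one_add_pow_le_exp (by linarith [hP.2]) s
    _ ≤ Real.exp (-a / 6) := by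
        rw [← Real.exp_add]
        apply Real.exp_le_exp.mpr
        nlinarith

/-- An additive Chernoff bound for the frequency of `A`. -/
lemma prob_add_le_countIn {n s : ℕ} {p : Fin n → ℝ} (hp : p ∈ stdSimplex ℝ (Fin n))
    (A : Finset (Fin n)) {a : ℝ} (ha0 : 0 ≤ a) (ha : a ≤ 1) :
    prob p (fun x : Fin s → Fin n => s * (∑ x ∈ A, p x + a) ≤ countIn x A) ≤
      Real.exp (-(s * (a ^ 2 / 4))) := by
  have hP := sum_mem_Icc_of_mem_stdSimplex hp A
  set P := ∑ x ∈ A, p x with hPdef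
  let Y : Fin n → ℝ := fun b => (if b ∈ A then 1 else 0) - P
  have hY : ∀ b, |Y b| ≤ 1 := fun b => by
    simp only [Y]
    rw [abs_le]
    split_ifs <;> constructor <;> linarith [hP.1, hP.2]
  have hEY : ∑ b, p b * Y b = 0 := by
    simp only [Y, mul_sub, Finset.sum_sub_distrib, ← Finset.sum_mul, hp.2]
    simp [hPdef]
  have hsum : ∀ x : Fin s → Fin n, ∑ i, Y (x i) = countIn x A - s * P := fun x => by
    simp [Y, countIn]
  -- Exponential parameter a/2: as `Y` is centred and bounded by 1, e^x ≤ 1 + x + x² costs a²/4,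
  -- against the gain a²/2 from the shift.
  have hmgf : ∑ b, p b * Real.exp (a / 2 * (Y b - a)) ≤ Real.exp (-(a ^ 2 / 4)) := by
    have h1 : ∀ b, Real.exp (a / 2 * Y b) ≤ 1 + a / 2 * Y b + (a / 2) ^ 2 := fun b => by
      have h := hY b
      have hle : |a / 2 * Y b| ≤ 1 := by
        rw [abs_mul, abs_of_nonneg (by linarith : 0 ≤ a / 2)]
        nlinarith [abs_nonneg (Y b)]
      have := (abs_le.mp (Real.abs_exp_sub_one_sub_id_le hle)).2
      have h2 : Y b ^ 2 ≤ 1 := by rw [← sq_abs]; nlinarith [abs_nonneg (Y b)]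
      nlinarith [sq_nonneg a]
    calc ∑ b, p b * Real.exp (a / 2 * (Y b - a))
        = Real.exp (-(a ^ 2 / 2)) * ∑ b, p b * Real.exp (a / 2 * Y b) := by
          rw [Finset.mul_sum]
          refine Finset.sum_congr rfl fun b _ => ?_
          rw [mul_left_comm, ← Real.exp_add]
          ring_nf
      _ ≤ Real.exp (-(a ^ 2 / 2)) * ∑ b, p b * (1 + a / 2 * Y b + (a / 2) ^ 2) := by
          gcongr with b
          · exact hp.1 b
          · exact h1 b
      _ = Real.exp (-(a ^ 2 / 2)) * (1 + (a / 2) ^ 2) := by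
          congr 1
          have : ∀ b, p b * (1 + a / 2 * Y b + (a / 2) ^ 2) =
              (1 + (a / 2) ^ 2) * p b + a / 2 * (p b * Y b) := fun b => by ring
          simp_rw [this]
          rw [Finset.sum_add_distrib, ← Finset.mul_sum, ← Finset.mul_sum, hp.2, hEY]
          ring
      _ ≤ Real.exp (-(a ^ 2 / 2)) * Real.exp ((a / 2) ^ 2) := by
          gcongr
          linarith [Real.add_one_le_exp ((a / 2) ^ 2)]
      _ = Real.exp (-(a ^ 2 / 4)) := by
          rw [← Real.exp_add]
          ring_nf
  calc prob p (fun x : Fin s → Fin n => s * (P + a) ≤ countIn x A)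
      ≤ expect p (fun x : Fin s → Fin n => ∏ i, Real.exp (a / 2 * (Y (x i) - a))) := by
        refine prob_le_expect hp (fun x => Finset.prod_nonneg fun i _ => (Real.exp_pos _).le)
          fun x hx => ?_
        rw [← Real.exp_sum, ← Finset.mul_sum, Finset.sum_sub_distrib, hsum]
        apply Real.one_le_exp
        refine mul_nonneg (by linarith) ?_
        simp
        linarith
    _ = (∑ b, p b * Real.exp (a / 2 * (Y b - a))) ^ s := by
        rw [expect_prod p (fun _ b => Real.exp (a / 2 * (Y b - a)))]
        simp
    _ ≤ Real.exp (-(a ^ 2 / 4)) ^ s := by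
        refine pow_le_pow_left₀ (Finset.sum_nonneg fun b _ => ?_) hmgf s
        exact mul_nonneg (hp.1 b) (Real.exp_pos _).le
    _ = Real.exp (-(s * (a ^ 2 / 4))) := by
        rw [← Real.exp_nat_mul]
        ring_nf

/-! ### Sums over pairs of samples -/

section PairSum

variable {α : Type*}

/-- The sum of `h` over all pairs of samples. -/
def pairSum {m : ℕ} (h : α → α → ℝ) (y : Fin m → α) : ℝ :=
  ∑ i, ∑ j, if i < j then h (y i) (y j) else 0

lemma pairSum_cons {m : ℕ} (h : α → α → ℝ) (a : α) (y : Fin m → α) :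
    pairSum h (Fin.cons a y : Fin (m + 1) → α) = ∑ j, h a (y j) + pairSum h y := by
  simp [pairSum, Fin.sum_univ_succ]

lemma pairSum_add {m : ℕ} (h h' : α → α → ℝ) (y : Fin m → α) :
    pairSum (fun a b => h a b + h' a b) y = pairSum h y + pairSum h' y := by
  simp only [pairSum, ← Finset.sum_add_distrib]
  refine Finset.sum_congr rfl fun i _ => Finset.sum_congr rfl fun j _ => ?_
  split_ifs <;> simp

lemma pairSum_const_mul {m : ℕ} (c : ℝ) (h : α → α → ℝ) (y : Fin m → α) :
    pairSum (fun a b => c * h a b) y = c * pairSum h y := by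
  simp only [pairSum, Finset.mul_sum]
  refine Finset.sum_congr rfl fun i _ => Finset.sum_congr rfl fun j _ => ?_
  split_ifs <;> simp

lemma pairSum_mono {m : ℕ} {h h' : α → α → ℝ} (hh : ∀ a b, h a b ≤ h' a b) (y : Fin m → α) :
    pairSum h y ≤ pairSum h' y :=
  Finset.sum_le_sum fun i _ => Finset.sum_le_sum fun j _ => by
    split_ifs
    · exact hh _ _
    · exact le_rfl

/-- Each sample belongs to m - 1 pairs. This gives the linear part of Hoeffding's decomposition. -/
lemma pairSum_separate (g : α → ℝ) : ∀ {m : ℕ} (y : Fin m → α),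
    pairSum (fun a b => g a + g b) y = (m - 1 : ℝ) * ∑ i, g (y i)
  | 0, y => by simp [pairSum]
  | m + 1, y => by
    rw [← Fin.cons_self_tail y, pairSum_cons, pairSum_separate g, Fin.sum_univ_succ,
      Finset.sum_add_distrib]
    simp
    ring

lemma pairSum_const (c : ℝ) {m : ℕ} (y : Fin m → α) :
    pairSum (fun _ _ => c) y = (m * (m - 1) / 2 : ℝ) * c := by
  have h := pairSum_separate (fun _ : α => c / 2) y
  simp only [add_halves] at h
  rw [h]
  simp
  ring

variable [Fintype α]

lemma expect_sum_apply {p : α → ℝ} (hp : p ∈ stdSimplex ℝ α) {f : α → ℝ}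
    (hf : ∑ a, p a * f a = 0) : ∀ m : ℕ, expect p (fun y : Fin m → α => ∑ i, f (y i)) = 0
  | 0 => by simp [expect]
  | m + 1 => by
    rw [expect_succ]
    simp only [Fin.sum_univ_succ, Fin.cons_zero, Fin.cons_succ, expect_add, expect_const hp,
      expect_sum_apply hp hf m, add_zero, hf]

lemma expect_sq_sum {p : α → ℝ} (hp : p ∈ stdSimplex ℝ α) {f : α → ℝ}
    (hf : ∑ a, p a * f a = 0) : ∀ m : ℕ,
    expect p (fun y : Fin m → α => (∑ i, f (y i)) ^ 2) = m * ∑ a, p a * f a ^ 2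
  | 0 => by simp [expect]
  | m + 1 => by
    rw [expect_succ]
    have h : ∀ a, expect p (fun y : Fin m → α =>
        (∑ i, f ((Fin.cons a y : Fin (m + 1) → α) i)) ^ 2) =
        f a ^ 2 + m * ∑ a, p a * f a ^ 2 := fun a => by
      simp only [Fin.sum_univ_succ, Fin.cons_zero, Fin.cons_succ, add_sq, expect_add,
        expect_const hp, expect_const_mul, expect_sum_apply hp hf m, expect_sq_sum hp hf m]
      ring
    simp_rw [h, mul_add]
    rw [Finset.sum_add_distrib, ← Finset.sum_mul, hp.2]
    push_cast
    ring

/-- The second moment of a sum over pairs, for a completely degenerate kernel. -/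
lemma expect_sq_pairSum {p : α → ℝ} (hp : p ∈ stdSimplex ℝ α) {w : α → α → ℝ}
    (hl : ∀ b, ∑ a, p a * w a b = 0) (hr : ∀ a, ∑ b, p b * w a b = 0) : ∀ m : ℕ,
    expect p (fun y : Fin m → α => pairSum w y ^ 2) =
      (m * (m - 1) / 2 : ℝ) * ∑ a, p a * ∑ b, p b * w a b ^ 2
  | 0 => by simp [expect, pairSum]
  | m + 1 => by
    rw [expect_succ]
    have h : ∀ a, expect p (fun y : Fin m → α =>
        pairSum w (Fin.cons a y : Fin (m + 1) → α) ^ 2) =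
        m * ∑ b, p b * w a b ^ 2 +
          2 * expect p (fun y : Fin m → α => (∑ j, w a (y j)) * pairSum w y) +
          (m * (m - 1) / 2 : ℝ) * ∑ a, p a * ∑ b, p b * w a b ^ 2 := fun a => by
      simp only [pairSum_cons, add_sq, expect_add, mul_assoc, expect_const_mul,
        expect_sq_sum hp (hr a) m]
      rw [expect_sq_pairSum hp hl hr m]
    -- The cross term vanishes on averaging over the new sample `a` first, since the old pairs do
    -- not involve it.
    have hmid : ∑ a, p a * expect p (fun y : Fin m → α => (∑ j, w a (y j)) * pairSum w y) = 0 := by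
      simp_rw [← expect_const_mul]
      rw [← expect_sum]
      have : ∀ y : Fin m → α, ∑ a, p a * ((∑ j, w a (y j)) * pairSum w y) = 0 := fun y => by
        simp_rw [← mul_assoc, ← Finset.sum_mul, Finset.mul_sum]
        rw [Finset.sum_comm]
        simp [hl]
      simp [this, expect]
    simp_rw [h, mul_add]
    rw [Finset.sum_add_distrib, Finset.sum_add_distrib, ← Finset.sum_mul, hp.2]
    have h1 : ∑ a, p a * (m * ∑ b, p b * w a b ^ 2) = m * ∑ a, p a * ∑ b, p b * w a b ^ 2 := by
      rw [Finset.mul_sum]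
      exact Finset.sum_congr rfl fun a _ => by ring
    have h2 : ∑ a, p a * (2 * expect p (fun y : Fin m → α => (∑ j, w a (y j)) * pairSum w y)) =
        0 := by
      simp_rw [mul_left_comm _ (2 : ℝ)]
      rw [← Finset.mul_sum, hmid, mul_zero]
    rw [h1, h2]
    push_cast
    ring

lemma sum_sq_sub_mean_le {p : α → ℝ} (hp : p ∈ stdSimplex ℝ α) (f : α → ℝ) :
    ∑ a, p a * (f a - ∑ b, p b * f b) ^ 2 ≤ ∑ a, p a * f a ^ 2 := by
  set μ := ∑ b, p b * f b with hμ
  have : ∀ a, p a * (f a - μ) ^ 2 = p a * f a ^ 2 - 2 * μ * (p a * f a) + μ ^ 2 * p a :=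
    fun a => by ring
  simp_rw [this]
  rw [Finset.sum_add_distrib, Finset.sum_sub_distrib, ← Finset.mul_sum, ← Finset.mul_sum, ← hμ,
    hp.2]
  nlinarith [sq_nonneg μ]

/-- A bound for the variance of a sum over pairs, by Hoeffding's decomposition. -/
lemma expect_sq_pairSum_sub_mean_le {p : α → ℝ} (hp : p ∈ stdSimplex ℝ α) {h : α → α → ℝ}
    (hs : ∀ a b, h a b = h b a) {m : ℕ} (hm : 1 ≤ m) :
    expect p (fun y : Fin m → α =>
        (pairSum h y - m * (m - 1) / 2 * ∑ a, p a * ∑ b, p b * h a b) ^ 2) ≤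
      2 * (m - 1) ^ 2 * m * ∑ a, p a * (∑ b, p b * h a b) ^ 2 +
        m * (m - 1) * ∑ a, p a * ∑ b, p b * h a b ^ 2 := by
  set g₀ : α → ℝ := fun a => ∑ b, p b * h a b with hg₀
  set μ : ℝ := ∑ a, p a * g₀ a with hμ
  set g : α → ℝ := fun a => g₀ a - μ with hg
  -- Hoeffding's decomposition h(a,b) = μ + g(a) + g(b) + w(a,b), in which `w` is centred in each
  -- variable.
  set w : α → α → ℝ := fun a b => (h a b - g₀ a) - (g₀ b - μ) with hw
  have hm' : (1 : ℝ) ≤ m := by exact_mod_cast hm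
  have hgsum : ∑ a, p a * g a = 0 := by
    simp only [hg, mul_sub, Finset.sum_sub_distrib, ← Finset.sum_mul, hp.2]
    rw [← hμ]
    ring
  have hg₀' : ∀ b, ∑ a, p a * h a b = g₀ b := fun b => by simp only [hg₀, hs _ b]
  have hkmean : ∀ b, ∑ a, p a * (h a b - g₀ a) = g₀ b - μ := fun b => by
    simp only [mul_sub, Finset.sum_sub_distrib, hg₀', hμ]
  have hwl : ∀ b, ∑ a, p a * w a b = 0 := fun b => by
    simp only [hw, mul_sub (p _) (h _ _ - g₀ _), Finset.sum_sub_distrib, hkmean, ← Finset.sum_mul,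
      hp.2]
    ring
  have hwr : ∀ a, ∑ b, p b * w a b = 0 := fun a => by
    simp only [hw, mul_sub, Finset.sum_sub_distrib, ← Finset.sum_mul, hp.2, ← hμ]
    simp [hg₀]
  have hdecomp : ∀ y : Fin m → α, pairSum h y - m * (m - 1) / 2 * μ =
      (m - 1) * ∑ i, g (y i) + pairSum w y := fun y => by
    rw [← pairSum_separate, ← pairSum_const, ← pairSum_add, sub_eq_iff_eq_add, ← pairSum_add]
    congr 1
    ext a b
    simp only [hg, hw]
    ring
  -- The kernel `w` arises from `h` by centring in `b` and then in `a`; neither operation increases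
  -- the second moment.
  have hwsq : ∑ a, p a * ∑ b, p b * w a b ^ 2 ≤ ∑ a, p a * ∑ b, p b * h a b ^ 2 := by
    calc ∑ a, p a * ∑ b, p b * w a b ^ 2 = ∑ b, p b * ∑ a, p a * w a b ^ 2 := by
          simp_rw [Finset.mul_sum]
          rw [Finset.sum_comm]
          exact Finset.sum_congr rfl fun b _ => Finset.sum_congr rfl fun a _ => by ring
      _ ≤ ∑ b, p b * ∑ a, p a * (h a b - g₀ a) ^ 2 := by
          refine Finset.sum_le_sum fun b _ => mul_le_mul_of_nonneg_left ?_ (hp.1 b)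
          have := sum_sq_sub_mean_le hp fun a => h a b - g₀ a
          rwa [hkmean b] at this
      _ = ∑ a, p a * ∑ b, p b * (h a b - g₀ a) ^ 2 := by
          simp_rw [Finset.mul_sum]
          rw [Finset.sum_comm]
          exact Finset.sum_congr rfl fun b _ => Finset.sum_congr rfl fun a _ => by ring
      _ ≤ ∑ a, p a * ∑ b, p b * h a b ^ 2 :=
          Finset.sum_le_sum fun a _ =>
            mul_le_mul_of_nonneg_left (sum_sq_sub_mean_le hp (h a)) (hp.1 a)
  have hgsq : ∑ a, p a * g a ^ 2 ≤ ∑ a, p a * g₀ a ^ 2 := sum_sq_sub_mean_le hp g₀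
  calc expect p (fun y : Fin m → α => (pairSum h y - m * (m - 1) / 2 * μ) ^ 2)
      ≤ expect p (fun y : Fin m → α =>
          2 * (m - 1) ^ 2 * (∑ i, g (y i)) ^ 2 + 2 * pairSum w y ^ 2) := by
        refine expect_mono hp.1 fun y => ?_
        rw [hdecomp]
        nlinarith [sq_nonneg (((m : ℝ) - 1) * ∑ i, g (y i) - pairSum w y)]
    _ = 2 * (m - 1) ^ 2 * (m * ∑ a, p a * g a ^ 2) +
          2 * ((m * (m - 1) / 2 : ℝ) * ∑ a, p a * ∑ b, p b * w a b ^ 2) := by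
        rw [expect_add, expect_const_mul, expect_const_mul, expect_sq_sum hp hgsum,
          expect_sq_pairSum hp hwl hwr]
    _ ≤ 2 * (m - 1) ^ 2 * (m * ∑ a, p a * g₀ a ^ 2) +
          2 * ((m * (m - 1) / 2 : ℝ) * ∑ a, p a * ∑ b, p b * h a b ^ 2) := by
        have : (0 : ℝ) ≤ m * (m - 1) / 2 := by
          have : (0 : ℝ) ≤ m - 1 := by linarith
          positivity
        gcongr
    _ = _ := by ring

/-- Chebyshev's inequality for a sum over pairs. -/
lemma prob_mul_pairSum_nonpos_le {p : α → ℝ} (hp : p ∈ stdSimplex ℝ α) {h : α → α → ℝ}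
    (hs : ∀ a b, h a b = h b a) {m : ℕ} (hm : 2 ≤ m) {μ G H : ℝ} (hμ0 : μ ≠ 0)
    (hμ : ∑ a, p a * ∑ b, p b * h a b = μ)
    (hG : ∑ a, p a * (∑ b, p b * h a b) ^ 2 ≤ G)
    (hH : ∑ a, p a * ∑ b, p b * h a b ^ 2 ≤ H) :
    prob p (fun y : Fin m → α => μ * pairSum h y ≤ 0) ≤
      8 * (G / (m * μ ^ 2) + H / (m * μ) ^ 2) := by
  have hm' : (2 : ℝ) ≤ m := by exact_mod_cast hm
  have hm1 : (0 : ℝ) < m - 1 := by linarith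
  have hm0 : (0 : ℝ) < m := by linarith
  have hμ2 : 0 < μ ^ 2 := by positivity
  set M : ℝ := m * (m - 1) / 2 with hM
  have hM0 : 0 < M := by positivity
  have hH0 : 0 ≤ H := le_trans (Finset.sum_nonneg fun a _ => mul_nonneg (hp.1 a)
    (Finset.sum_nonneg fun b _ => mul_nonneg (hp.1 b) (sq_nonneg _))) hH
  have hvar := expect_sq_pairSum_sub_mean_le hp hs (m := m) (by omega)
  rw [hμ, ← hM] at hvar
  calc prob p (fun y : Fin m → α => μ * pairSum h y ≤ 0)
      ≤ expect p (fun y : Fin m → α => ((M * μ) ^ 2)⁻¹ * (pairSum h y - M * μ) ^ 2) := by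
        refine prob_le_expect hp (fun y => by positivity) fun y hy => ?_
        -- A sum whose sign is not that of `μ` lies at distance at least |Mμ| from its mean Mμ; this
        -- covers both signs of `μ`.
        rw [inv_mul_eq_div, one_le_div (by positivity)]
        nlinarith [sq_nonneg (pairSum h y)]
    _ ≤ ((M * μ) ^ 2)⁻¹ * (2 * (m - 1) ^ 2 * m * G + m * (m - 1) * H) := by
        rw [expect_const_mul]
        refine mul_le_mul_of_nonneg_left (hvar.trans ?_) (by positivity)
        gcongr
    _ = 8 * (G / (m * μ ^ 2)) + 4 * m / (m - 1) * (H / (m * μ) ^ 2) := by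
        rw [hM]
        field_simp
        ring
    _ ≤ 8 * (G / (m * μ ^ 2)) + 8 * (H / (m * μ) ^ 2) := by
        gcongr
        rw [div_le_iff₀ hm1]
        linarith
    _ = _ := by ring

end PairSum

/-! ### The collision test -/

lemma countIn_cons {n m : ℕ} (a : Fin n) (y : Fin m → Fin n) (D : Finset (Fin n)) :
    countIn (Fin.cons a y : Fin (m + 1) → Fin n) D = (if a ∈ D then 1 else 0) + countIn y D := by
  simp only [countIn, Finset.card_filter, Fin.sum_univ_succ, Fin.cons_zero, Fin.cons_succ]

lemma choose_countIn_eq_pairSum {n : ℕ} (D : Finset (Fin n)) : ∀ {m : ℕ} (y : Fin m → Fin n),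
    ((countIn y D).choose 2 : ℝ) = pairSum (fun a b => if a ∈ D ∧ b ∈ D then 1 else 0) y
  | 0, y => by simp [pairSum, countIn]
  | m + 1, y => by
    rw [← Fin.cons_self_tail y, pairSum_cons, ← choose_countIn_eq_pairSum D, countIn_cons]
    by_cases h : y 0 ∈ D
    · simp only [h, if_true, true_and, add_comm 1, Nat.choose_succ_succ', Nat.choose_one_right]
      simp [countIn]
    · simp [h]

lemma collisions_eq_pairSum {n m : ℕ} (y : Fin m → Fin n) (D : Finset (Fin n)) :
    (collisions y D : ℝ) = pairSum (fun a b => if a = b ∧ a ∈ D then 1 else 0) y := by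
  rw [collisions, Finset.card_filter, Fintype.sum_prod_type, pairSum]
  push_cast
  refine Finset.sum_congr rfl fun i _ => Finset.sum_congr rfl fun j _ => ?_
  by_cases h : i < j <;> simp [h]

/-- The kernel whose sum over pairs of samples compares the number of collisions in `D` with a
fraction `θ` of the number of pairs in `D`. -/
def collisionKernel {n : ℕ} (D : Finset (Fin n)) (θ : ℝ) (a b : Fin n) : ℝ :=
  (if a = b ∧ a ∈ D then 1 else 0) + -θ * (if a ∈ D ∧ b ∈ D then 1 else 0)

lemma pairSum_collisionKernel {n m : ℕ} (y : Fin m → Fin n) (D : Finset (Fin n)) (θ : ℝ) :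
    pairSum (collisionKernel D θ) y = collisions y D - θ * (countIn y D).choose 2 := by
  rw [collisions_eq_pairSum, choose_countIn_eq_pairSum, sub_eq_add_neg, ← neg_mul,
    ← pairSum_const_mul, ← pairSum_add]
  rfl

lemma collisions_le_choose {n m : ℕ} (y : Fin m → Fin n) (D : Finset (Fin n)) :
    (collisions y D : ℝ) ≤ (countIn y D).choose 2 := by
  rw [collisions_eq_pairSum, choose_countIn_eq_pairSum]
  refine pairSum_mono (fun a b => ?_) y
  by_cases h : a = b
  · subst h; simp
  · simp only [h, false_and, if_false]
    split_ifs <;> norm_num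

/-- Clearing the random denominator turns a threshold on the estimate into the sign of a sum over
pairs. Only weak signs can be claimed: without pairs in `D` the sum is 0, whatever the estimate
reads. -/
lemma pairSum_nonneg_of_le_estimate {n m : ℕ} {y : Fin m → Fin n} {D : Finset (Fin n)} {τ : ℝ}
    (hD : 0 < D.card) (h : τ / (D.card : ℝ) ≤ l2SqEstimate y D) :
    0 ≤ pairSum (collisionKernel D ((1 + τ) / (D.card : ℝ))) y := by
  have hd : (0 : ℝ) < D.card := by exact_mod_cast hD
  rw [pairSum_collisionKernel]
  rw [l2SqEstimate] at h
  rcases Nat.eq_zero_or_pos ((countIn y D).choose 2) with h0 | h0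
  · rw [h0]
    simp
  · have hc : (0 : ℝ) < (countIn y D).choose 2 := by exact_mod_cast h0
    have : (1 + τ) / (D.card : ℝ) ≤ collisions y D / (countIn y D).choose 2 := by
      rw [add_div]; linarith
    rw [le_div_iff₀ hc] at this
    linarith

lemma pairSum_nonpos_of_estimate_lt {n m : ℕ} {y : Fin m → Fin n} {D : Finset (Fin n)} {τ : ℝ}
    (h : l2SqEstimate y D < τ / (D.card : ℝ)) :
    pairSum (collisionKernel D ((1 + τ) / (D.card : ℝ))) y ≤ 0 := by
  rw [pairSum_collisionKernel]
  rw [l2SqEstimate] at h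
  rcases Nat.eq_zero_or_pos ((countIn y D).choose 2) with h0 | h0
  · have := collisions_le_choose y D
    rw [h0] at this ⊢
    simpa using this
  · have hc : (0 : ℝ) < (countIn y D).choose 2 := by exact_mod_cast h0
    have : (collisions y D : ℝ) / (countIn y D).choose 2 ≤ (1 + τ) / (D.card : ℝ) := by
      rw [add_div]; linarith
    rw [div_le_iff₀ hc] at this
    linarith

section Moments

variable {n : ℕ} (p : Fin n → ℝ) (D : Finset (Fin n)) (θ : ℝ)

lemma collisionKernel_comm (a b : Fin n) : collisionKernel D θ a b = collisionKernel D θ b a := by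
  unfold collisionKernel
  by_cases h : a = b
  · rw [h]
  · simp [h, Ne.symm h, and_comm]

lemma sum_collisionKernel (a : Fin n) :
    ∑ b, p b * collisionKernel D θ a b = if a ∈ D then p a - θ * ∑ b ∈ D, p b else 0 := by
  by_cases h : a ∈ D
  · simp only [collisionKernel, h, and_true, true_and, if_true, mul_add, Finset.sum_add_distrib]
    simp [Finset.mul_sum]
    rw [← sub_eq_add_neg]
    congr 1
    exact Finset.sum_congr rfl fun b _ => by ring
  · simp [collisionKernel, h]

/-- With `sum_sq_eq_sum_sq_sub_add` and θ = (1 + 4e²)/|D| this mean becomes V - 4e²P²/|D|, so its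
sign compares the deviation V from uniformity with the threshold of the test. -/
lemma sum_sum_collisionKernel :
    ∑ a, p a * ∑ b, p b * collisionKernel D θ a b =
      ∑ a ∈ D, p a ^ 2 - θ * (∑ a ∈ D, p a) ^ 2 := by
  simp only [sum_collisionKernel, mul_ite, mul_zero, Finset.sum_ite_mem, Finset.univ_inter,
    mul_sub, Finset.sum_sub_distrib, ← Finset.sum_mul]
  rw [show ∑ a ∈ D, p a * p a = ∑ a ∈ D, p a ^ 2 from
    Finset.sum_congr rfl fun a _ => by ring]
  ring

lemma sum_sq_sum_collisionKernel :
    ∑ a, p a * (∑ b, p b * collisionKernel D θ a b) ^ 2 =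
      ∑ a ∈ D, p a * (p a - θ * ∑ b ∈ D, p b) ^ 2 := by
  simp only [sum_collisionKernel, ite_pow, mul_ite, ne_eq, OfNat.ofNat_ne_zero, not_false_eq_true,
    zero_pow, mul_zero, Finset.sum_ite_mem, Finset.univ_inter]

variable {p θ}

/-- The squared kernel is dominated by the collision kernel with parameter -θ²: they agree off the
diagonal, and (1 - θ)² ≤ 1 + θ² on it. -/
lemma sum_sum_sq_collisionKernel_le (hp : ∀ a, 0 ≤ p a) (hθ : 0 ≤ θ) :
    ∑ a, p a * ∑ b, p b * collisionKernel D θ a b ^ 2 ≤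
      ∑ a ∈ D, p a ^ 2 + θ ^ 2 * (∑ a ∈ D, p a) ^ 2 := by
  have h : ∀ a b, collisionKernel D θ a b ^ 2 ≤ collisionKernel D (-θ ^ 2) a b := fun a b => by
    unfold collisionKernel
    by_cases hab : a = b
    · subst hab
      by_cases ha : a ∈ D <;> simp [ha]
      nlinarith
    · simp [hab]
  calc ∑ a, p a * ∑ b, p b * collisionKernel D θ a b ^ 2
      ≤ ∑ a, p a * ∑ b, p b * collisionKernel D (-θ ^ 2) a b :=
        Finset.sum_le_sum fun a _ => mul_le_mul_of_nonneg_left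
          (Finset.sum_le_sum fun b _ => mul_le_mul_of_nonneg_left (h a b) (hp b)) (hp a)
    _ = _ := by rw [sum_sum_collisionKernel]; ring

variable (p)

lemma sum_sq_eq_sum_sq_sub_add (hD : 0 < D.card) :
    ∑ a ∈ D, p a ^ 2 = ∑ a ∈ D, (p a - (∑ b ∈ D, p b) / D.card) ^ 2 +
      (∑ b ∈ D, p b) ^ 2 / D.card := by
  have hd : (D.card : ℝ) ≠ 0 := by exact_mod_cast hD.ne'
  set P := ∑ b ∈ D, p b with hP
  have : ∀ a, (p a - P / D.card) ^ 2 = p a ^ 2 - 2 * (P / D.card) * p a + (P / D.card) ^ 2 :=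
    fun a => by ring
  simp_rw [this]
  rw [Finset.sum_add_distrib, Finset.sum_sub_distrib, ← Finset.mul_sum, ← hP]
  simp
  field_simp
  ring

end Moments

/-! Elementary inequalities behind the two tail bounds: `P` is the mass of a set of size `d`,
`A` the average mass of its elements, and `V` the sum of the squared deviations from `A`. -/

/-- Here A + 4e²A is θP. The hypothesis 2A ≤ P says that the set has at least two elements. -/
lemma sq_threshold_le {A P e : ℝ} (hA : 0 < A) (he : 0 < e) (he' : e ≤ 1 / 7)
    (hAP : 2 * A ≤ P) : (A + 4 * e ^ 2 * A) ^ 2 ≤ A * P := by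
  have h2 : e ^ 2 ≤ 1 / 49 := by nlinarith
  have h3 : A + 4 * e ^ 2 * A ≤ 53 / 49 * A := by nlinarith
  have h4 : (A + 4 * e ^ 2 * A) ^ 2 ≤ (53 / 49 * A) ^ 2 :=
    pow_le_pow_left₀ (by positivity) h3 2
  nlinarith

lemma sq_sub_threshold_le {A e x : ℝ} (hA : 0 < A) (he : 0 < e) (he' : e ≤ 1 / 7)
    (hx : |x - A| ≤ e * A) : (x - (A + 4 * e ^ 2 * A)) ^ 2 ≤ (2 * e * A) ^ 2 := by
  have h := abs_le.mp hx
  have h1 : 0 < e * A := mul_pos he hA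
  have h2 : 4 * e ^ 2 * A ≤ e * A := by nlinarith
  have h3 : 0 < e ^ 2 * A := by positivity
  apply sq_le_sq' <;> linarith [h.1, h.2]

/-- The first ratio is of order 1/(mPe²). In the second, AP = P²/d, so its order is d/(mPe²)²; this
is what requires mPe² to be large compared with √d. -/
lemma near_uniform_moment_bounds {m P A d e μ : ℝ} (hm : 0 < m) (hP : 0 < P) (hA : 0 < A)
    (he : 0 < e) (hd : 1 ≤ d) (hPA : P = A * d) (hmP : 10000 * √d ≤ m * P * e ^ 2)
    (hμ : 9 * e ^ 4 * (A * P) ^ 2 ≤ μ ^ 2) :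
    4 * e ^ 2 * A ^ 2 * P / (m * μ ^ 2) ≤ 1 / 1000 ∧ 3 * A * P / (m * μ) ^ 2 ≤ 1 / 1000 := by
  have hμ2 : 0 < μ ^ 2 := lt_of_lt_of_le (by positivity) hμ
  have hsd : (1 : ℝ) ≤ √d := Real.one_le_sqrt.mpr hd
  have hmP1 : 10000 ≤ m * P * e ^ 2 := by linarith
  have hmP2 : 10000 ^ 2 * d ≤ (m * P * e ^ 2) ^ 2 := by
    calc 10000 ^ 2 * d = (10000 * √d) ^ 2 := by rw [mul_pow, Real.sq_sqrt (by linarith)]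
      _ ≤ _ := pow_le_pow_left₀ (by positivity) hmP 2
  constructor
  · rw [div_le_iff₀ (by positivity)]
    calc 4 * e ^ 2 * A ^ 2 * P = 4 * (e ^ 2 * A ^ 2 * P) := by ring
      _ ≤ 9 / 1000 * (m * P * e ^ 2) * (e ^ 2 * A ^ 2 * P) :=
          mul_le_mul_of_nonneg_right (by linarith) (by positivity)
      _ = 1 / 1000 * (m * (9 * e ^ 4 * (A * P) ^ 2)) := by ring
      _ ≤ _ := by gcongr
  · rw [mul_pow, div_le_iff₀ (by positivity)]
    calc 3 * A * P = 3 * d * A ^ 2 := by rw [hPA]; ring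
      _ ≤ 9 / 1000 * (m * P * e ^ 2) ^ 2 * A ^ 2 :=
          mul_le_mul_of_nonneg_right (by linarith) (by positivity)
      _ = 1 / 1000 * (m ^ 2 * (9 * e ^ 4 * (A * P) ^ 2)) := by ring
      _ ≤ _ := by gcongr

/-- Everything reduces to mV being large compared with A and to m√V being large, both of which
follow from V ≥ 9e²AP. -/
lemma far_from_uniform_moment_bounds {m P A d e V μ : ℝ} (hm : 0 < m) (hP : 0 < P) (hA : 0 < A)
    (he : 0 < e) (he1 : e ≤ 1) (hd : 1 ≤ d) (hPA : P = A * d)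
    (hmP : 10000 * √d ≤ m * P * e ^ 2) (hV : 9 * (e ^ 2 * A * P) ≤ V)
    (hμ : 25 / 81 * V ^ 2 ≤ μ ^ 2) :
    (2 * (A + √V) * V + 32 * e ^ 4 * A ^ 2 * P) / (m * μ ^ 2) ≤ 1 / 1000 ∧
      (V + 2 * A * P) / (m * μ) ^ 2 ≤ 1 / 1000 := by
  have hd0 : 0 < d := by linarith
  have hV0 : 0 < V := lt_of_lt_of_le (by positivity) hV
  have hsV : √V ^ 2 = V := Real.sq_sqrt hV0.le
  have hsV0 : 0 < √V := Real.sqrt_pos.mpr hV0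
  have hsd : (1 : ℝ) ≤ √d := Real.one_le_sqrt.mpr hd
  have hmP1 : 10000 ≤ m * P * e ^ 2 := by linarith
  have hmP2 : 10000 ^ 2 * d ≤ (m * P * e ^ 2) ^ 2 := by
    calc 10000 ^ 2 * d = (10000 * √d) ^ 2 := by rw [mul_pow, Real.sq_sqrt hd0.le]
      _ ≤ _ := pow_le_pow_left₀ (by positivity) hmP 2
  have he2 : e ^ 2 ≤ 1 := pow_le_one₀ he.le he1
  have hμ0 : 0 < μ ^ 2 := lt_of_lt_of_le (by positivity) hμ
  have hmV : 90000 * A ≤ m * V := by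
    calc 90000 * A = 9 * 10000 * A := by ring
      _ ≤ 9 * (m * P * e ^ 2) * A := by gcongr
      _ = m * (9 * (e ^ 2 * A * P)) := by ring
      _ ≤ m * V := by gcongr
  have hmsV2 : 10000 ^ 2 ≤ m ^ 2 * V := by
    have h1 : 10000 ^ 2 * d ≤ (m * P) ^ 2 * e ^ 2 := by
      calc 10000 ^ 2 * d ≤ (m * P) ^ 2 * e ^ 2 * e ^ 2 := by linarith
        _ ≤ (m * P) ^ 2 * e ^ 2 * 1 := by gcongr
        _ = _ := by ring
    have h2 : (m * P) ^ 2 * e ^ 2 = m ^ 2 * (e ^ 2 * A * P) * d := by rw [hPA]; ring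
    rw [h2] at h1
    have h3 := le_of_mul_le_mul_right h1 hd0
    have h4 : (m : ℝ) ^ 2 * (9 * (e ^ 2 * A * P)) ≤ m ^ 2 * V := by gcongr
    have h5 : 0 ≤ (m : ℝ) ^ 2 * (e ^ 2 * A * P) := by positivity
    linarith
  have hmsV : 10000 ≤ m * √V := by
    refine le_of_sq_le_sq ?_ (by positivity)
    rwa [mul_pow, hsV]
  have hVsq : (9 * (e ^ 2 * A * P)) ^ 2 ≤ V ^ 2 := pow_le_pow_left₀ (by positivity) hV 2
  constructor
  · rw [div_le_iff₀ (by positivity)]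
    have t1 : 2 * A * V ≤ 1 / 40000 * (m * V ^ 2) := by
      calc 2 * A * V ≤ 1 / 40000 * (m * V) * V :=
            mul_le_mul_of_nonneg_right (by linarith) (by positivity)
        _ = _ := by ring
    have t2 : 2 * √V * V ≤ 2 / 10000 * (m * V ^ 2) := by
      calc 2 * √V * V = 2 / 10000 * 10000 * (√V * V) := by ring
        _ ≤ 2 / 10000 * (m * √V) * (√V * V) := by gcongr
        _ = 2 / 10000 * (m * (√V ^ 2 * V)) := by ring
        _ = _ := by rw [hsV]; ring
    have t3 : 32 * e ^ 4 * A ^ 2 * P ≤ 1 / 20000 * (m * V ^ 2) := by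
      have h2 : 10000 ≤ m * P := by
        have : m * P * e ^ 2 ≤ m * P * 1 := by gcongr
        linarith
      calc 32 * e ^ 4 * A ^ 2 * P = 32 * (e ^ 4 * A ^ 2 * P) := by ring
        _ ≤ 81 / 20000 * (m * P) * (e ^ 4 * A ^ 2 * P) :=
          mul_le_mul_of_nonneg_right (by linarith) (by positivity)
        _ = 1 / 20000 * (m * (9 * (e ^ 2 * A * P)) ^ 2) := by ring
        _ ≤ _ := by gcongr
    have t4 : m * (25 / 81 * V ^ 2) ≤ m * μ ^ 2 := by gcongr
    have t5 : 0 < m * V ^ 2 := by positivity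
    have t6 : 2 * (A + √V) * V = 2 * A * V + 2 * √V * V := by ring
    rw [t6]
    linarith
  · rw [mul_pow, div_le_iff₀ (by positivity)]
    have t1 : V ≤ 1 / 10000 * (m ^ 2 * V ^ 2) := by
      calc V = 1 / 10000 * 10000 * V := by ring
        _ ≤ 1 / 10000 * (m ^ 2 * V) * V :=
          mul_le_mul_of_nonneg_right (by linarith) (by positivity)
        _ = _ := by ring
    have t2 : 2 * A * P ≤ 1 / 10000 * (m ^ 2 * V ^ 2) := by
      calc 2 * A * P = 2 * d * A ^ 2 := by rw [hPA]; ring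
        _ ≤ 81 / 10000 * (m * P * e ^ 2) ^ 2 * A ^ 2 :=
          mul_le_mul_of_nonneg_right (by linarith) (by positivity)
        _ = 1 / 10000 * (m ^ 2 * (9 * (e ^ 2 * A * P)) ^ 2) := by ring
        _ ≤ _ := by gcongr
    have t4 : m ^ 2 * (25 / 81 * V ^ 2) ≤ m ^ 2 * μ ^ 2 := by gcongr
    have t5 : 0 < (m : ℝ) ^ 2 * V ^ 2 := by positivity
    linarith

/-- The collision test is unlikely to reject a distribution that is nearly uniform on `D`. -/
lemma prob_le_estimate_of_near_uniform {n m : ℕ} {p : Fin n → ℝ}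
    (hp : p ∈ stdSimplex ℝ (Fin n)) {D : Finset (Fin n)} {e : ℝ} (he : 0 < e) (he' : e ≤ 1 / 7)
    (hD : 2 ≤ D.card) (hP : 0 < ∑ a ∈ D, p a) (hm : 2 ≤ m)
    (hmP : 10000 * √(D.card : ℝ) ≤ m * (∑ a ∈ D, p a) * e ^ 2)
    (hu : ∀ a ∈ D, |p a - (∑ b ∈ D, p b) / D.card| ≤ e * ((∑ b ∈ D, p b) / D.card)) :
    prob p (fun y : Fin m → Fin n => (2 * e) ^ 2 / (D.card : ℝ) ≤ l2SqEstimate y D) ≤ 1 / 36 := by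
  have hd2 : (2 : ℝ) ≤ D.card := by exact_mod_cast hD
  have hm0 : (0 : ℝ) < m := by exact_mod_cast (by omega : 0 < m)
  have hS := sum_sq_eq_sum_sq_sub_add p D (by omega)
  have hμ := sum_sum_collisionKernel p D ((1 + (2 * e) ^ 2) / D.card)
  have hG := sum_sq_sum_collisionKernel p D ((1 + (2 * e) ^ 2) / D.card)
  have hH := sum_sum_sq_collisionKernel_le D (θ := (1 + (2 * e) ^ 2) / D.card) hp.1 (by positivity)
  generalize hPdef : ∑ a ∈ D, p a = P at hP hmP hu hS hμ hG hH
  obtain ⟨A, hA⟩ : ∃ A, A = P / D.card := ⟨_, rfl⟩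
  have hA0 : 0 < A := by rw [hA]; positivity
  have hPA : P = A * D.card := by rw [hA]; field_simp
  have hθP : (1 + (2 * e) ^ 2) / D.card * P = A + 4 * e ^ 2 * A := by rw [hA]; ring
  have hAP : 2 * A ≤ P := by
    rw [hPA, mul_comm]
    exact mul_le_mul_of_nonneg_left hd2 hA0.le
  rw [hS, ← hA] at hμ hH
  rw [hθP] at hG
  rw [← mul_pow, hθP] at hH
  rw [← hA] at hu
  have hVle : ∑ a ∈ D, (p a - A) ^ 2 ≤ e ^ 2 * A * P := by
    calc ∑ a ∈ D, (p a - A) ^ 2 ≤ ∑ a ∈ D, (e * A) ^ 2 := Finset.sum_le_sum fun a ha => by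
          rw [← sq_abs]
          exact pow_le_pow_left₀ (abs_nonneg _) (hu a ha) 2
      _ = e ^ 2 * A * P := by
          rw [Finset.sum_const, nsmul_eq_mul, hPA]; ring
  have hPP : P ^ 2 / D.card = A * P := by rw [hA]; ring
  rw [hPP] at hμ hH
  obtain ⟨V, hV⟩ : ∃ V, V = ∑ a ∈ D, (p a - A) ^ 2 := ⟨_, rfl⟩
  rw [← hV] at hμ hH hVle
  obtain ⟨μ, hμdef⟩ : ∃ μ, μ = V + A * P - (1 + (2 * e) ^ 2) / D.card * P ^ 2 := ⟨_, rfl⟩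
  -- The deviation V is at most e²AP and the threshold is 4e²AP.
  have hμle : 3 * e ^ 2 * (A * P) ≤ -μ := by
    have : (1 + (2 * e) ^ 2) / D.card * P ^ 2 = (A + 4 * e ^ 2 * A) * P := by rw [← hθP]; ring
    rw [hμdef, this]
    linarith
  have hμ0 : μ < 0 := by
    have : 0 < 3 * e ^ 2 * (A * P) := by positivity
    linarith
  have hμsq : 9 * e ^ 4 * (A * P) ^ 2 ≤ μ ^ 2 := by
    calc 9 * e ^ 4 * (A * P) ^ 2 = (3 * e ^ 2 * (A * P)) ^ 2 := by ring
      _ ≤ (-μ) ^ 2 := pow_le_pow_left₀ (by positivity) hμle 2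
      _ = μ ^ 2 := by ring
  have hG' : ∑ a ∈ D, p a * (p a - (A + 4 * e ^ 2 * A)) ^ 2 ≤ 4 * e ^ 2 * A ^ 2 * P := by
    calc ∑ a ∈ D, p a * (p a - (A + 4 * e ^ 2 * A)) ^ 2 ≤ ∑ a ∈ D, p a * (2 * e * A) ^ 2 :=
          Finset.sum_le_sum fun a ha => mul_le_mul_of_nonneg_left
            (sq_sub_threshold_le hA0 he he' (hu a ha)) (hp.1 a)
      _ = 4 * e ^ 2 * A ^ 2 * P := by rw [← Finset.sum_mul, hPdef]; ring
  have hH' : V + A * P + (A + 4 * e ^ 2 * A) ^ 2 ≤ 3 * A * P := by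
    have h1 := sq_threshold_le hA0 he he' hAP
    have h2 : e ^ 2 * (A * P) ≤ 1 * (A * P) := by
      gcongr
      exact pow_le_one₀ he.le (by linarith)
    linarith
  obtain ⟨b1, b2⟩ := near_uniform_moment_bounds hm0 hP hA0 he (by linarith) hPA hmP hμsq
  rw [← hμdef] at hμ
  refine (prob_mono hp
    (E' := fun y => μ * pairSum (collisionKernel D ((1 + (2 * e) ^ 2) / D.card)) y ≤ 0)
    fun y hy => ?_).trans ((prob_mul_pairSum_nonpos_le hp (collisionKernel_comm D _) hm hμ0.ne
      hμ (hG.trans_le hG') (hH.trans hH')).trans (by linarith))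
  exact mul_nonpos_of_nonpos_of_nonneg hμ0.le (pairSum_nonneg_of_le_estimate (by omega) hy)

/-- The collision test is unlikely to accept a distribution that is far from uniform on `D`. -/
lemma prob_estimate_lt_of_far_from_uniform {n m : ℕ} {p : Fin n → ℝ}
    (hp : p ∈ stdSimplex ℝ (Fin n)) {D : Finset (Fin n)} {e : ℝ} (he : 0 < e) (he' : e ≤ 1 / 7)
    (hD : 2 ≤ D.card) (hP : 0 < ∑ a ∈ D, p a) (hm : 2 ≤ m)
    (hmP : 10000 * √(D.card : ℝ) ≤ m * (∑ a ∈ D, p a) * e ^ 2)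
    (hV : 9 * e ^ 2 * (∑ a ∈ D, p a) ^ 2 / D.card ≤
      ∑ a ∈ D, (p a - (∑ b ∈ D, p b) / D.card) ^ 2) :
    prob p (fun y : Fin m → Fin n => l2SqEstimate y D < (2 * e) ^ 2 / (D.card : ℝ)) ≤ 1 / 36 := by
  have hd2 : (2 : ℝ) ≤ D.card := by exact_mod_cast hD
  have hm0 : (0 : ℝ) < m := by exact_mod_cast (by omega : 0 < m)
  have hS := sum_sq_eq_sum_sq_sub_add p D (by omega)
  have hμ := sum_sum_collisionKernel p D ((1 + (2 * e) ^ 2) / D.card)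
  have hG := sum_sq_sum_collisionKernel p D ((1 + (2 * e) ^ 2) / D.card)
  have hH := sum_sum_sq_collisionKernel_le D (θ := (1 + (2 * e) ^ 2) / D.card) hp.1 (by positivity)
  generalize hPdef : ∑ a ∈ D, p a = P at hP hmP hV hS hμ hG hH
  obtain ⟨A, hA⟩ : ∃ A, A = P / D.card := ⟨_, rfl⟩
  have hA0 : 0 < A := by rw [hA]; positivity
  have hPA : P = A * D.card := by rw [hA]; field_simp
  have hθP : (1 + (2 * e) ^ 2) / D.card * P = A + 4 * e ^ 2 * A := by rw [hA]; ring
  have hAP : 2 * A ≤ P := by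
    rw [hPA, mul_comm]
    exact mul_le_mul_of_nonneg_left hd2 hA0.le
  rw [hS, ← hA] at hμ hH
  rw [hθP] at hG
  rw [← mul_pow, hθP] at hH
  have hPP : P ^ 2 / D.card = A * P := by rw [hA]; ring
  rw [hPP] at hμ hH
  rw [mul_div_assoc, hPP, ← hA] at hV
  obtain ⟨V, hVdef⟩ : ∃ V, V = ∑ a ∈ D, (p a - A) ^ 2 := ⟨_, rfl⟩
  rw [← hVdef] at hμ hH hV
  obtain ⟨μ, hμdef⟩ : ∃ μ, μ = V + A * P - (1 + (2 * e) ^ 2) / D.card * P ^ 2 := ⟨_, rfl⟩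
  have hV0 : 0 < V := lt_of_lt_of_le (by positivity) hV
  -- The threshold 4e²AP is at most 4V/9.
  have hμle : 5 / 9 * V ≤ μ := by
    have : (1 + (2 * e) ^ 2) / D.card * P ^ 2 = (A + 4 * e ^ 2 * A) * P := by rw [← hθP]; ring
    rw [hμdef, this]
    linarith
  have hμ0 : 0 < μ := by linarith
  have hμsq : 25 / 81 * V ^ 2 ≤ μ ^ 2 := by
    calc 25 / 81 * V ^ 2 = (5 / 9 * V) ^ 2 := by ring
      _ ≤ μ ^ 2 := pow_le_pow_left₀ (by positivity) hμle 2
  -- A single deviation is at most √V, which reduces the third moment to the second: p(a) ≤ A + √V.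
  have hle : ∀ a ∈ D, p a - A ≤ √V := fun a ha => by
    apply Real.le_sqrt_of_sq_le
    rw [hVdef]
    exact Finset.single_le_sum (f := fun a => (p a - A) ^ 2) (fun b _ => sq_nonneg _) ha
  have hG' : ∑ a ∈ D, p a * (p a - (A + 4 * e ^ 2 * A)) ^ 2 ≤
      2 * (A + √V) * V + 32 * e ^ 4 * A ^ 2 * P := by
    calc ∑ a ∈ D, p a * (p a - (A + 4 * e ^ 2 * A)) ^ 2
        ≤ ∑ a ∈ D, (2 * (A + √V) * (p a - A) ^ 2 + 2 * (4 * e ^ 2 * A) ^ 2 * p a) := by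
          refine Finset.sum_le_sum fun a ha => ?_
          have h1 : (p a - (A + 4 * e ^ 2 * A)) ^ 2 ≤
              2 * (p a - A) ^ 2 + 2 * (4 * e ^ 2 * A) ^ 2 := by
            linarith [sq_nonneg (p a - A + 4 * e ^ 2 * A)]
          have h2 : p a * (p a - A) ^ 2 ≤ (A + √V) * (p a - A) ^ 2 :=
            mul_le_mul_of_nonneg_right (by linarith [hle a ha]) (sq_nonneg _)
          have h3 := mul_le_mul_of_nonneg_left h1 (hp.1 a)
          linarith
      _ = 2 * (A + √V) * V + 32 * e ^ 4 * A ^ 2 * P := by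
          rw [Finset.sum_add_distrib, ← Finset.mul_sum, ← Finset.mul_sum, hPdef, ← hVdef]; ring
  have hH' : V + A * P + (A + 4 * e ^ 2 * A) ^ 2 ≤ V + 2 * A * P := by
    linarith [sq_threshold_le hA0 he he' hAP]
  obtain ⟨b1, b2⟩ := far_from_uniform_moment_bounds hm0 hP hA0 he (by linarith) (by linarith) hPA
    hmP (by linarith) hμsq
  rw [← hμdef] at hμ
  refine (prob_mono hp
    (E' := fun y => μ * pairSum (collisionKernel D ((1 + (2 * e) ^ 2) / D.card)) y ≤ 0)
    fun y hy => ?_).trans ((prob_mul_pairSum_nonpos_le hp (collisionKernel_comm D _) hm hμ0.ne'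
      hμ (hG.trans_le hG') (hH.trans hH')).trans (by linarith))
  exact mul_nonpos_of_nonneg_of_nonpos hμ0.le (pairSum_nonpos_of_estimate_lt hy)

/-! ### Buckets -/

section Buckets

variable {n : ℕ} {q : Fin n → ℝ} {η : ℝ}

/-- The bucket of `x` is the first threshold that q(x) does not exceed; both uniqueness and
existence of the bucket follow. -/
lemma mem_bucket_iff (hη : 0 < η) {x : Fin n} {j : ℕ} :
    x ∈ bucket q η j ↔
      q x ≤ (1 + η) ^ j * η ^ 2 / n ∧ ∀ i < j, (1 + η) ^ i * η ^ 2 / n < q x := by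
  cases j with
  | zero => simp [bucket]
  | succ j =>
    simp only [bucket, Finset.mem_filter, Finset.mem_univ, true_and]
    refine ⟨fun h => ⟨h.2, fun i hi => lt_of_le_of_lt ?_ h.1⟩, fun h => ⟨h.2 j (by omega), h.1⟩⟩
    gcongr
    · linarith
    · omega

lemma bucket_unique (hη : 0 < η) {x : Fin n} {i j : ℕ} (hi : x ∈ bucket q η i)
    (hj : x ∈ bucket q η j) : i = j := by
  rw [mem_bucket_iff hη] at hi hj
  rcases lt_trichotomy i j with h | h | h
  · exact absurd hi.1 (not_le.mpr (hj.2 i h))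
  · exact h
  · exact absurd hj.1 (not_le.mpr (hi.2 j h))

lemma exists_mem_bucket (hη : 0 < η) (hq : q ∈ stdSimplex ℝ (Fin n)) (x : Fin n) :
    ∃ j < numBuckets n η, x ∈ bucket q η j := by
  have hn : (0 : ℝ) < n := by exact_mod_cast (Fin.pos x)
  have hx : q x ≤ 1 := by
    rw [← hq.2]
    exact Finset.single_le_sum (fun a _ => hq.1 a) (Finset.mem_univ x)
  set N := ⌈Real.log (n / η ^ 2) / Real.log (1 + η)⌉₊ with hN
  have hlog : 0 < Real.log (1 + η) := Real.log_pos (by linarith)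
  have htop : q x ≤ (1 + η) ^ N * η ^ 2 / n := by
    refine hx.trans ?_
    have h1 : Real.log (n / η ^ 2) ≤ N * Real.log (1 + η) := by
      rw [← div_le_iff₀ hlog]
      exact Nat.le_ceil _
    rw [← Real.log_pow, Real.log_le_log_iff (by positivity) (by positivity),
      div_le_iff₀ (by positivity)] at h1
    rwa [le_div_iff₀ hn, one_mul]
  have hex : ∃ j, q x ≤ (1 + η) ^ j * η ^ 2 / n := ⟨N, htop⟩
  refine ⟨Nat.find hex, Nat.lt_succ_of_le (Nat.find_min' hex htop), ?_⟩
  rw [mem_bucket_iff hη]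
  exact ⟨Nat.find_spec hex, fun i hi => not_le.mp (Nat.find_min hex hi)⟩

end Buckets

/-! ### Pieces -/

section Pieces

variable {n : ℕ}

/-- The number of elements of `S` before `x`. -/
def rankIn (S : Finset (Fin n)) (x : Fin n) : ℕ := Finset.card {y ∈ S | y < x}

lemma mem_piece {t : ℕ} {S : Finset (Fin n)} {l : ℕ} {x : Fin n} :
    x ∈ piece t S l ↔ x ∈ S ∧ rankIn S x * numPieces n t S.card / S.card = l := by
  simp [piece, rankIn]

lemma rankIn_mono (S : Finset (Fin n)) {x y : Fin n} (h : x ≤ y) : rankIn S x ≤ rankIn S y :=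
  Finset.card_le_card fun z hz => by
    simp only [Finset.mem_filter] at hz ⊢
    exact ⟨hz.1, hz.2.trans_le h⟩

lemma rankIn_lt {S : Finset (Fin n)} {x y : Fin n} (hx : x ∈ S) (h : x < y) :
    rankIn S x < rankIn S y := by
  refine Finset.card_lt_card ⟨fun z hz => ?_, fun hsub => ?_⟩
  · simp only [Finset.mem_filter] at hz ⊢
    exact ⟨hz.1, hz.2.trans h⟩
  · have := hsub (by simp [hx, h] : x ∈ Finset.filter (fun z => z < y) S)
    simp at this

lemma rankIn_lt_card {S : Finset (Fin n)} {x : Fin n} (hx : x ∈ S) : rankIn S x < S.card := by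
  refine Finset.card_lt_card ⟨Finset.filter_subset _ _, fun hsub => ?_⟩
  have := hsub hx
  simp at this

lemma rankIn_injOn (S : Finset (Fin n)) : Set.InjOn (rankIn S) S := by
  intro x hx y hy h
  rcases lt_trichotomy x y with hlt | heq | hlt
  · exact absurd h (rankIn_lt hx hlt).ne
  · exact heq
  · exact absurd h (rankIn_lt hy hlt).ne'

lemma numPieces_pos (n t z : ℕ) : 0 < numPieces n t z := by
  unfold numPieces
  split_ifs <;> positivity

lemma mul_numPieces_le (n t z : ℕ) : n * numPieces n t z ≤ z * t + n := by
  unfold numPieces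
  split_ifs
  · rw [mul_add, mul_one]
    exact Nat.add_le_add_right (Nat.mul_div_le _ _) _
  · omega

lemma exists_mem_piece (t : ℕ) {S : Finset (Fin n)} {x : Fin n} (hx : x ∈ S) :
    ∃ l < numPieces n t S.card, x ∈ piece t S l := by
  refine ⟨_, ?_, mem_piece.mpr ⟨hx, rfl⟩⟩
  have h := rankIn_lt_card hx
  rw [Nat.div_lt_iff_lt_mul (by omega), mul_comm]
  exact Nat.mul_lt_mul_of_pos_left h (numPieces_pos _ _ _)

/-- A split set of size z has L = ⌊zt/n⌋ + 1 pieces, so z < L⌈n/t⌉. The ranks a with ⌊aL/z⌋ = l lie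
in a half-open window of length z/L. -/
lemma card_piece_le (hn : 0 < n) {t : ℕ} (ht : 0 < t) (S : Finset (Fin n)) (l : ℕ) :
    (piece t S l).card ≤ ⌈(n : ℝ) / t⌉₊ := by
  rcases le_or_gt S.card ⌈(n : ℝ) / t⌉₊ with hz | hz
  · exact (Finset.card_le_card fun x hx => (mem_piece.mp hx).1).trans hz
  set M := ⌈(n : ℝ) / t⌉₊ with hM
  set L := numPieces n t S.card with hL
  have hzLM : S.card ≤ L * M := by
    have h1 : S.card * t < L * n := by
      rw [hL, numPieces, if_pos hz, mul_comm _ n]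
      exact Nat.lt_mul_div_succ _ hn
    have h2 : n ≤ M * t := by
      have : (n : ℝ) / t ≤ M := Nat.le_ceil _
      rw [div_le_iff₀ (by exact_mod_cast ht)] at this
      exact_mod_cast this
    have h3 : S.card * t < L * M * t := by
      calc S.card * t < L * n := h1
        _ ≤ L * (M * t) := Nat.mul_le_mul_left _ h2
        _ = L * M * t := by ring
    exact (lt_of_mul_lt_mul_right h3 (Nat.zero_le _)).le
  have hzpos : 0 < S.card := by omega
  rcases (piece t S l).eq_empty_or_nonempty with he | hne
  · rw [he]; simp
  have hinj : Set.InjOn (rankIn S) (piece t S l) :=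
    (rankIn_injOn S).mono fun x hx => (mem_piece.mp hx).1
  rw [← Finset.card_image_of_injOn hinj]
  have hne' := hne.image (rankIn S)
  set a₀ := ((piece t S l).image (rankIn S)).min' hne' with ha₀
  have hval : ∀ a ∈ (piece t S l).image (rankIn S), a * L / S.card = l := by
    intro a ha
    obtain ⟨x, hx, rfl⟩ := Finset.mem_image.mp ha
    exact (mem_piece.mp hx).2
  have hsub : (piece t S l).image (rankIn S) ⊆ Finset.Ico a₀ (a₀ + M) := by
    intro a ha
    rw [Finset.mem_Ico]
    refine ⟨Finset.min'_le _ _ ha, ?_⟩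
    have h1 := hval a ha
    have h2 := hval a₀ (Finset.min'_mem _ _)
    have h3 : a * L < (l + 1) * S.card := by
      rw [← Nat.div_lt_iff_lt_mul hzpos]; omega
    have h4 : l * S.card ≤ a₀ * L := by
      rw [← Nat.le_div_iff_mul_le hzpos]; omega
    have h5 : a * L < (a₀ + M) * L := by nlinarith
    exact lt_of_mul_lt_mul_right h5 (Nat.zero_le _)
  simpa using Finset.card_le_card hsub

end Pieces

/-! ### The refined division -/

section Division

variable {n k : ℕ} {I : Segmentation n k} {q : Fin n → ℝ} {η : ℝ} {D : Finset (Fin n)}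

lemma mem_refinedDivision : D ∈ refinedDivision I q η ↔
    ∃ i, ∃ j < numBuckets n η,
      ∃ l < numPieces n (k * numBuckets n η) (I.part i ∩ bucket q η j).card,
        piece (k * numBuckets n η) (I.part i ∩ bucket q η j) l = D := by
  simp [refinedDivision]

lemma exists_subset_of_mem_refinedDivision (hD : D ∈ refinedDivision I q η) :
    ∃ i j, D ⊆ I.part i ∧ D ⊆ bucket q η j := by
  obtain ⟨i, j, -, l, -, rfl⟩ := mem_refinedDivision.mp hD
  exact ⟨i, j, fun x hx => (Finset.mem_inter.mp (mem_piece.mp hx).1).1,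
    fun x hx => (Finset.mem_inter.mp (mem_piece.mp hx).1).2⟩

lemma part_unique (I : Segmentation n k) {x : Fin n} {i i' : Fin k} (h : x ∈ I.part i)
    (h' : x ∈ I.part i') : i = i' := by
  by_contra hne
  exact Finset.disjoint_left.mp (I.disjoint i i' hne) h h'

lemma refinedDivision_unique (hη : 0 < η) {D' : Finset (Fin n)}
    (hD : D ∈ refinedDivision I q η) (hD' : D' ∈ refinedDivision I q η) {x : Fin n}
    (hx : x ∈ D) (hx' : x ∈ D') : D = D' := by
  obtain ⟨i, j, -, l, -, rfl⟩ := mem_refinedDivision.mp hD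
  obtain ⟨i', j', -, l', -, rfl⟩ := mem_refinedDivision.mp hD'
  rw [mem_piece, Finset.mem_inter] at hx hx'
  obtain rfl := part_unique I hx.1.1 hx'.1.1
  obtain rfl := bucket_unique hη hx.1.2 hx'.1.2
  rw [← hx.2, ← hx'.2]

lemma exists_mem_refinedDivision (hη : 0 < η) (hq : q ∈ stdSimplex ℝ (Fin n)) (x : Fin n) :
    ∃ D ∈ refinedDivision I q η, x ∈ D := by
  obtain ⟨i, hi⟩ := I.cover x
  obtain ⟨j, hj, hxj⟩ := exists_mem_bucket hη hq x
  obtain ⟨l, hl, hxl⟩ := exists_mem_piece (k * numBuckets n η) (Finset.mem_inter.mpr ⟨hi, hxj⟩)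
  exact ⟨_, mem_refinedDivision.mpr ⟨i, j, hj, l, hl, rfl⟩, hxl⟩

lemma pairwiseDisjoint_refinedDivision (hη : 0 < η) :
    (refinedDivision I q η : Set (Finset (Fin n))).PairwiseDisjoint id := by
  intro D hD D' hD' hne
  rw [Function.onFun, id, id, Finset.disjoint_left]
  exact fun x hx hx' => hne (refinedDivision_unique hη hD hD' hx hx')

lemma sum_refinedDivision (hη : 0 < η) (hq : q ∈ stdSimplex ℝ (Fin n)) (f : Fin n → ℝ) :
    ∑ D ∈ refinedDivision I q η, ∑ x ∈ D, f x = ∑ x, f x := by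
  have hU : (Finset.univ : Finset (Fin n)) = (refinedDivision I q η).biUnion id := by
    ext x
    simpa using exists_mem_refinedDivision hη hq x
  rw [hU, Finset.sum_biUnion (pairwiseDisjoint_refinedDivision hη)]
  rfl

/-- A cell of size z has at most zt/n + 1 pieces. There are t disjoint cells, whose sizes sum to at
most n, so the total is at most t + t. -/
lemma card_refinedDivision_le (hn : 0 < n) (hη : 0 < η) :
    (refinedDivision I q η).card ≤ 2 * (k * numBuckets n η) := by
  set t := k * numBuckets n η with ht
  set v := numBuckets n η with hv
  have h1 : (refinedDivision I q η).card ≤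
      ∑ i : Fin k, ∑ j ∈ Finset.range v, numPieces n t (I.part i ∩ bucket q η j).card := by
    unfold refinedDivision
    refine Finset.card_biUnion_le.trans (Finset.sum_le_sum fun i _ => ?_)
    refine Finset.card_biUnion_le.trans (Finset.sum_le_sum fun j _ => ?_)
    exact Finset.card_image_le.trans (by simp [ht, hv])
  have h2 : ∑ i : Fin k, ∑ j ∈ Finset.range v, (I.part i ∩ bucket q η j).card ≤ n := by
    calc ∑ i : Fin k, ∑ j ∈ Finset.range v, (I.part i ∩ bucket q η j).card
        ≤ ∑ i : Fin k, (I.part i).card := by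
          refine Finset.sum_le_sum fun i _ => ?_
          rw [← Finset.card_biUnion]
          · refine Finset.card_le_card fun x hx => ?_
            simp only [Finset.mem_biUnion, Finset.mem_inter] at hx
            obtain ⟨j, -, hx⟩ := hx
            exact hx.1
          · intro j _ j' _ hne
            rw [Function.onFun, Finset.disjoint_left]
            intro x hx hx'
            exact hne (bucket_unique hη (Finset.mem_inter.mp hx).2 (Finset.mem_inter.mp hx').2)
      _ = (Finset.univ.biUnion I.part).card :=
          (Finset.card_biUnion fun i _ j _ hne => I.disjoint i j hne).symm
      _ ≤ n := by simpa using Finset.card_le_univ (Finset.univ.biUnion I.part)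
  have h3 : n * (refinedDivision I q η).card ≤ n * (2 * t) := by
    calc n * (refinedDivision I q η).card
        ≤ n * ∑ i : Fin k, ∑ j ∈ Finset.range v,
            numPieces n t (I.part i ∩ bucket q η j).card := Nat.mul_le_mul_left _ h1
      _ ≤ ∑ i : Fin k, ∑ j ∈ Finset.range v, ((I.part i ∩ bucket q η j).card * t + n) := by
          rw [Finset.mul_sum]
          refine Finset.sum_le_sum fun i _ => ?_
          rw [Finset.mul_sum]
          exact Finset.sum_le_sum fun j _ => mul_numPieces_le _ _ _
      _ = (∑ i : Fin k, ∑ j ∈ Finset.range v, (I.part i ∩ bucket q η j).card) * t + t * n := by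
          simp only [Finset.sum_add_distrib, Finset.sum_mul]
          simp [ht, mul_assoc]
      _ ≤ n * t + t * n := by gcongr
      _ = n * (2 * t) := by ring
  exact Nat.le_of_mul_le_mul_left h3 hn

lemma card_nonempty_refinedDivision_le (hη : 0 < η) :
    Finset.card {D ∈ refinedDivision I q η | D.Nonempty} ≤ n := by
  have hd : (Finset.filter (fun D => D.Nonempty) (refinedDivision I q η) :
      Set (Finset (Fin n))).PairwiseDisjoint id :=
    (pairwiseDisjoint_refinedDivision hη).subset fun D hD =>
      (Finset.mem_filter.mp hD).1
  calc Finset.card {D ∈ refinedDivision I q η | D.Nonempty}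
      = ∑ D ∈ refinedDivision I q η with D.Nonempty, 1 := by simp
    _ ≤ ∑ D ∈ refinedDivision I q η with D.Nonempty, (id D).card :=
        Finset.sum_le_sum fun D hD => Finset.card_pos.mpr (Finset.mem_filter.mp hD).2
    _ = ((Finset.filter (fun D => D.Nonempty) (refinedDivision I q η)).biUnion id).card :=
        (Finset.card_biUnion hd).symm
    _ ≤ n := by
        simpa using Finset.card_le_univ
          ((Finset.filter (fun D => D.Nonempty) (refinedDivision I q η)).biUnion id)

/-- For t ≥ n all pieces have at most one element. Otherwise a piece has size at most n/t + 1 ≤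
2n/t. -/
lemma card_le_of_mem_refinedDivision (hk : 1 ≤ k) (hD : D ∈ refinedDivision I q η)
    (hD2 : 2 ≤ D.card) : k * numBuckets n η < n ∧
      (D.card : ℝ) * ((k * numBuckets n η : ℕ) : ℝ) ≤ 2 * n := by
  have hn : 0 < n := by
    obtain ⟨x, -⟩ := Finset.card_pos.mp (by omega : 0 < D.card)
    exact Fin.pos x
  obtain ⟨i, j, -, l, -, rfl⟩ := mem_refinedDivision.mp hD
  have ht : 0 < k * numBuckets n η := Nat.mul_pos hk (by unfold numBuckets; omega)
  have hle := card_piece_le hn ht (I.part i ∩ bucket q η j) l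
  generalize k * numBuckets n η = t at *
  generalize (piece t (I.part i ∩ bucket q η j) l).card = d at *
  have ht' : (0 : ℝ) < t := by exact_mod_cast ht
  have htn : t < n := by
    by_contra hge
    push Not at hge
    have : ⌈(n : ℝ) / t⌉₊ ≤ 1 := by
      rw [Nat.ceil_le, div_le_iff₀ ht']
      push_cast
      rw [one_mul]
      exact_mod_cast hge
    omega
  refine ⟨htn, ?_⟩
  have h1 : (⌈(n : ℝ) / t⌉₊ : ℝ) < n / t + 1 := Nat.ceil_lt_add_one (by positivity)
  have h2 : (d : ℝ) ≤ ⌈(n : ℝ) / t⌉₊ := by exact_mod_cast hle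
  have h3 : (d : ℝ) * t ≤ (n / t + 1) * t := by gcongr; linarith
  have h4 : ((n : ℝ) / t + 1) * t = n + t := by field_simp
  have h5 : (t : ℝ) ≤ n := by exact_mod_cast htn.le
  linarith

/-- The elements between `a` and `b` that share their bucket with `a`. -/
def run {n : ℕ} (q : Fin n → ℝ) (η : ℝ) (ab : Fin n × Fin n) : Finset (Fin n) :=
  {z | (∀ j, z ∈ bucket q η j ↔ ab.1 ∈ bucket q η j) ∧ ab.1 ≤ z ∧ z ≤ ab.2}

/-- Intervals are convex and the piece number is monotone in the rank, so within its bucket a piece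
consists of all elements between its extremes. Hence all segmentations together produce at most n²
nonempty sets, and union bounds need not range over segmentations. -/
lemma exists_eq_run (hη : 0 < η) (hD : D ∈ refinedDivision I q η) (hne : D.Nonempty) :
    ∃ ab, D = run q η ab := by
  obtain ⟨i, j, -, l, -, rfl⟩ := mem_refinedDivision.mp hD
  set t := k * numBuckets n η
  set S := I.part i ∩ bucket q η j with hS
  set a := (piece t S l).min' hne
  set b := (piece t S l).max' hne
  have ha : a ∈ piece t S l := Finset.min'_mem _ _
  have hb : b ∈ piece t S l := Finset.max'_mem _ _
  rw [mem_piece, hS, Finset.mem_inter] at ha hb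
  refine ⟨(a, b), ?_⟩
  ext z
  simp only [run, Finset.mem_filter, Finset.mem_univ, true_and]
  constructor
  · intro hz
    refine ⟨fun j' => ?_, Finset.min'_le _ _ hz, Finset.le_max' _ _ hz⟩
    rw [mem_piece, hS, Finset.mem_inter] at hz
    constructor
    · intro h
      rw [← bucket_unique hη hz.1.2 h]
      exact ha.1.2
    · intro h
      rw [← bucket_unique hη ha.1.2 h]
      exact hz.1.2
  · rintro ⟨hz, haz, hzb⟩
    rw [mem_piece]
    refine ⟨Finset.mem_inter.mpr ⟨?_, (hz j).mpr ha.1.2⟩, le_antisymm ?_ ?_⟩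
    · exact_mod_cast (I.ordConnected i).out (by exact_mod_cast ha.1.1) (by exact_mod_cast hb.1.1)
        ⟨haz, hzb⟩
    · rw [← hb.2]
      exact Nat.div_le_div_right (Nat.mul_le_mul_right _ (rankIn_mono S hzb))
    · rw [← ha.2]
      exact Nat.div_le_div_right (Nat.mul_le_mul_right _ (rankIn_mono S haz))

end Division

/-! ### The parameters of the tester -/

section Parameters

variable {n k : ℕ} {ε : ℝ}

/-- The number of intersections of intervals and buckets. -/
def numCells (n k : ℕ) (ε : ℝ) : ℕ := k * numBuckets n (ε / 14 / 4)

lemma numCells_pos (hk : 1 ≤ k) : 1 ≤ numCells n k ε :=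
  Nat.mul_pos hk (Nat.succ_pos _)

lemma log_two_mul_le (hn : 1 ≤ n) (hε : 0 < ε) (hε2 : ε ≤ 2) :
    Real.log (2 * n) ≤ Real.log (4 * n / ε) := by
  have hn' : (1 : ℝ) ≤ n := by exact_mod_cast hn
  apply Real.log_le_log (by positivity)
  rw [le_div_iff₀ hε]
  nlinarith

lemma half_le_log (hn : 1 ≤ n) (hε : 0 < ε) (hε2 : ε ≤ 2) : 1 / 2 ≤ Real.log (4 * n / ε) := by
  have hn' : (1 : ℝ) ≤ n := by exact_mod_cast hn
  have h1 := log_two_mul_le hn hε hε2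
  have h2 : Real.log 2 ≤ Real.log (2 * n) := Real.log_le_log (by norm_num) (by linarith)
  have := Real.log_two_gt_d9
  linarith

/-- The error budget of a union bound over the n² runs; it holds because 4n/ε ≥ 2n. -/
lemma exp_neg_log_le (hn : 1 ≤ n) (hε : 0 < ε) (hε2 : ε ≤ 2) :
    (n : ℝ) ^ 2 * Real.exp (-(10 * Real.log (4 * n / ε))) ≤ 1 / 1024 := by
  have hn' : (1 : ℝ) ≤ n := by exact_mod_cast hn
  have h1 := log_two_mul_le hn hε hε2
  calc (n : ℝ) ^ 2 * Real.exp (-(10 * Real.log (4 * n / ε)))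
      ≤ (n : ℝ) ^ 2 * Real.exp (-(((10 : ℕ) : ℝ) * Real.log (2 * n))) := by
        push_cast
        gcongr
    _ = (n : ℝ) ^ 2 / (2 * n) ^ 10 := by
        rw [Real.exp_neg, Real.exp_nat_mul, Real.exp_log (by positivity)]
        rfl
    _ = 1 / 1024 * (1 / (n : ℝ) ^ 8) := by
        field_simp
        norm_num
    _ ≤ 1 / 1024 * 1 := by
        gcongr
        rw [div_le_one (by positivity)]
        exact one_le_pow₀ hn'
    _ = 1 / 1024 := by ring

lemma le_numBatches (n : ℕ) (ε : ℝ) :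
    10 * Real.log (4 * n / ε) ≤ numBatches 10 n ε := Nat.le_ceil _

lemma le_batchSize (n k : ℕ) (ε : ℝ) :
    10 ^ 9 * √((n : ℝ) * numCells n k ε) / ε ^ 3 ≤ batchSize (10 ^ 9) n k ε := Nat.le_ceil _

lemma one_third_pow_le (n : ℕ) (ε : ℝ) :
    (1 / 3 : ℝ) ^ numBatches 10 n ε ≤ Real.exp (-(10 * Real.log (4 * n / ε))) := by
  calc (1 / 3 : ℝ) ^ numBatches 10 n ε ≤ Real.exp (-1) ^ numBatches 10 n ε := by
        gcongr
        rw [Real.exp_neg, ← one_div]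
        gcongr
        exact Real.exp_one_lt_three.le
    _ = Real.exp (-(numBatches 10 n ε : ℝ)) := by
        rw [← Real.exp_nat_mul]
        ring_nf
    _ ≤ _ := by
        gcongr
        exact le_numBatches n ε

lemma one_le_sqrt_mul_numCells (hn : 1 ≤ n) (hk : 1 ≤ k) :
    1 ≤ √((n : ℝ) * numCells n k ε) := by
  rw [Real.one_le_sqrt]
  have : 1 ≤ n * numCells n k ε := Nat.mul_pos hn (numCells_pos hk)
  exact_mod_cast this

lemma cube_le (hε : 0 < ε) (hε2 : ε ≤ 2) : ε ^ 3 ≤ 8 := by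
  calc ε ^ 3 ≤ 2 ^ 3 := pow_le_pow_left₀ hε.le hε2 3
    _ = 8 := by norm_num

lemma two_le_batchSize (hn : 1 ≤ n) (hk : 1 ≤ k) (hε : 0 < ε) (hε2 : ε ≤ 2) :
    2 ≤ batchSize (10 ^ 9) n k ε := by
  have h := le_batchSize n k ε
  have h1 : (2 : ℝ) ≤ 10 ^ 9 * √((n : ℝ) * numCells n k ε) / ε ^ 3 := by
    rw [le_div_iff₀ (by positivity)]
    linarith [one_le_sqrt_mul_numCells (ε := ε) hn hk, cube_le hε hε2]
  exact_mod_cast h1.trans h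

/-- A batch is large enough for the collision test on a set of size `d` and mass `P`. -/
lemma le_batchSize_mul (hk : 1 ≤ k) (hε : 0 < ε) {d P : ℝ} (hd : 0 ≤ d)
    (hdt : d * numCells n k ε ≤ 2 * n) (hP : ε / 14 / (8 * numCells n k ε) ≤ P) :
    10000 * √d ≤ batchSize (10 ^ 9) n k ε * P * (ε / 14) ^ 2 := by
  have h := le_batchSize n k ε
  have ht : (1 : ℝ) ≤ numCells n k ε := by exact_mod_cast numCells_pos hk
  generalize (numCells n k ε : ℝ) = t at *
  -- Squared, this is t²d/4 ≤ nt/2, a consequence of dt ≤ 2n. Below, 43904 = 2 · 8 · 14³.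
  have h1 : t * √d / 2 ≤ √(n * t) := by
    apply Real.le_sqrt_of_sq_le
    rw [div_pow, mul_pow, Real.sq_sqrt hd]
    nlinarith
  calc 10000 * √d ≤ 10 ^ 9 * (t * √d / 2) / ε ^ 3 * (ε / 14 / (8 * t)) * (ε / 14) ^ 2 := by
        have : 10 ^ 9 * (t * √d / 2) / ε ^ 3 * (ε / 14 / (8 * t)) * (ε / 14) ^ 2 =
            10 ^ 9 / 43904 * √d := by
          field_simp
          ring
        rw [this]
        gcongr
        norm_num
    _ ≤ 10 ^ 9 * √(n * t) / ε ^ 3 * P * (ε / 14) ^ 2 := by gcongr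
    _ ≤ _ := by
        have : 0 ≤ P := le_trans (by positivity) hP
        gcongr

lemma le_numSamples (hn : 1 ≤ n) (hε : 0 < ε) (hε2 : ε ≤ 2) :
    10 ^ 10 * Real.log (4 * n / ε) * √((n : ℝ) * numCells n k ε) / ε ^ 3 ≤
      ((numBatches 10 n ε * batchSize (10 ^ 9) n k ε : ℕ) : ℝ) := by
  have hl := half_le_log hn hε hε2
  push_cast
  calc 10 ^ 10 * Real.log (4 * n / ε) * √((n : ℝ) * numCells n k ε) / ε ^ 3
      = (10 * Real.log (4 * n / ε)) * (10 ^ 9 * √((n : ℝ) * numCells n k ε) / ε ^ 3) := by ring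
    _ ≤ _ := by
        gcongr
        · exact le_numBatches n ε
        · exact le_batchSize n k ε

lemma numSamples_pos (hn : 1 ≤ n) (hk : 1 ≤ k) (hε : 0 < ε) (hε2 : ε ≤ 2) :
    (0 : ℝ) < ((numBatches 10 n ε * batchSize (10 ^ 9) n k ε : ℕ) : ℝ) := by
  refine lt_of_lt_of_le ?_ (le_numSamples hn hε hε2)
  have hl := half_le_log hn hε hε2
  have := one_le_sqrt_mul_numCells (ε := ε) hn hk
  positivity

/-- The number of samples suffices to estimate the mass of a set that is not a singleton. -/
lemma exp_threshold_le (hn : 1 ≤ n) (hk : 1 ≤ k) (hε : 0 < ε) (hε2 : ε ≤ 2)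
    (htn : numCells n k ε < n) {a : ℝ}
    (ha : ε / 14 * ((numBatches 10 n ε * batchSize (10 ^ 9) n k ε : ℕ) : ℝ) /
      (4 * numCells n k ε) ≤ a) :
    Real.exp (-a / 6) ≤ Real.exp (-(10 * Real.log (4 * n / ε))) := by
  have hl := half_le_log hn hε hε2
  have hs := le_numSamples (k := k) hn hε hε2
  have ht : (1 : ℝ) ≤ numCells n k ε := by exact_mod_cast numCells_pos hk
  have htn' : (numCells n k ε : ℝ) ≤ n := by exact_mod_cast htn.le
  generalize (numCells n k ε : ℝ) = t at *
  generalize ((numBatches 10 n ε * batchSize (10 ^ 9) n k ε : ℕ) : ℝ) = s at *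
  generalize Real.log (4 * n / ε) = ℓ at *
  -- This uses t < n. It is why the mass estimates are claimed only when sets with two elements can
  -- occur.
  have h1 : t ≤ √(n * t) := by
    apply Real.le_sqrt_of_sq_le
    nlinarith
  rw [Real.exp_le_exp]
  have h2 : 60 * ℓ ≤ ε / 14 * s / (4 * t) := by
    calc 60 * ℓ ≤ ε / 14 * (10 ^ 10 * ℓ * t / ε ^ 3) / (4 * t) := by
          have h3 : ε / 14 * (10 ^ 10 * ℓ * t / ε ^ 3) / (4 * t) = 10 ^ 10 / 56 * ℓ / ε ^ 2 := by
            field_simp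
            norm_num
          rw [h3, le_div_iff₀ (by positivity)]
          have h4 : ε ^ 2 ≤ 2 ^ 2 := pow_le_pow_left₀ hε.le hε2 2
          have h5 : 60 * ℓ * ε ^ 2 ≤ 60 * ℓ * 2 ^ 2 := by gcongr
          linarith
      _ ≤ ε / 14 * (10 ^ 10 * ℓ * √(n * t) / ε ^ 3) / (4 * t) := by gcongr
      _ ≤ _ := by gcongr
  linarith

/-- The number of samples suffices for a union bound over all unions of at most `N` runs. -/
lemma pow_mul_exp_le (hn : 1 ≤ n) (hk : 1 ≤ k) (hε : 0 < ε) (hε2 : ε ≤ 2) {N : ℕ} (hN : N ≤ n)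
    (hN' : N ≤ 2 * numCells n k ε) :
    ((n : ℝ) ^ 2 + 1) ^ N *
      Real.exp (-(((numBatches 10 n ε * batchSize (10 ^ 9) n k ε : ℕ) : ℝ) *
        ((ε / 14 / 2) ^ 2 / 4))) ≤ Real.exp (-(10 * Real.log (4 * n / ε))) := by
  have hn' : (1 : ℝ) ≤ n := by exact_mod_cast hn
  have hl := half_le_log hn hε hε2
  have hl2 := log_two_mul_le hn hε hε2
  have hs := le_numSamples (k := k) hn hε hε2
  have hsq := one_le_sqrt_mul_numCells (ε := ε) hn hk
  have hN1 : (N : ℝ) ≤ n := by exact_mod_cast hN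
  have hN2 : (N : ℝ) ≤ 2 * numCells n k ε := by exact_mod_cast hN'
  generalize (numCells n k ε : ℝ) = t at *
  generalize ((numBatches 10 n ε * batchSize (10 ^ 9) n k ε : ℕ) : ℝ) = s at *
  -- Each of the N slots of a union holds one of n² runs or stays empty.
  have hpow : ((n : ℝ) ^ 2 + 1) ^ N ≤ Real.exp (N * (2 * Real.log (4 * n / ε))) := by
    rw [Real.exp_nat_mul]
    refine pow_le_pow_left₀ (by positivity) ?_ N
    calc (n : ℝ) ^ 2 + 1 ≤ (2 * n) ^ 2 := by nlinarith
      _ = Real.exp (2 * Real.log (2 * n)) := by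
          rw [two_mul (Real.log _), Real.exp_add, Real.exp_log (by positivity)]
          ring
      _ ≤ _ := by gcongr
  -- The product of N ≤ n and N ≤ 2t; neither bound alone would suffice for all t.
  have hNsq : N / 2 ≤ √(n * t) := by
    apply Real.le_sqrt_of_sq_le
    nlinarith [(Nat.cast_nonneg N : (0 : ℝ) ≤ N)]
  generalize Real.log (4 * n / ε) = ℓ at *
  generalize √(n * t) = w at *
  calc ((n : ℝ) ^ 2 + 1) ^ N * Real.exp (-(s * ((ε / 14 / 2) ^ 2 / 4)))
      ≤ Real.exp (N * (2 * ℓ)) * Real.exp (-(s * ((ε / 14 / 2) ^ 2 / 4))) := by gcongr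
    _ ≤ Real.exp (-(10 * ℓ)) := by
        rw [← Real.exp_add, Real.exp_le_exp]
        have h1 : 100 * ℓ * w ≤ s * ((ε / 14 / 2) ^ 2 / 4) := by
          calc 100 * ℓ * w ≤ 10 ^ 10 * ℓ * w / ε ^ 3 * ((ε / 14 / 2) ^ 2 / 4) := by
                have h3 : 10 ^ 10 * ℓ * w / ε ^ 3 * ((ε / 14 / 2) ^ 2 / 4) =
                    10 ^ 10 / 3136 * ℓ * w / ε := by
                  field_simp
                  norm_num
                rw [h3, le_div_iff₀ hε]
                have h5 : 100 * ℓ * w * ε ≤ 100 * ℓ * w * 2 := by gcongr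
                have h6 : 0 ≤ ℓ * w := by positivity
                linarith
            _ ≤ _ := by gcongr
        have h2 : N / 2 * ℓ ≤ w * ℓ := by gcongr
        have h3 : 1 * ℓ ≤ w * ℓ := by gcongr
        linarith

/-- As log(1 + η) ≥ η/2 and η = ε/56, the number of buckets is of order log(n/ε)/ε. The constant is
1128 = 2 · 10 · 56 + 8, with 8 for the rounding. -/
lemma numBuckets_le (hn : 1 ≤ n) (hε : 0 < ε) (hε2 : ε ≤ 2) :
    (numBuckets n (ε / 14 / 4) : ℝ) ≤ 1128 * Real.log (4 * n / ε) / ε := by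
  have hn' : (1 : ℝ) ≤ n := by exact_mod_cast hn
  have hl := half_le_log hn hε hε2
  obtain ⟨η, hη⟩ : ∃ η, η = ε / 14 / 4 := ⟨_, rfl⟩
  have hη0 : 0 < η := by rw [hη]; positivity
  have hη1 : η ≤ 1 := by rw [hη]; linarith
  have hεη : ε = 56 * η := by rw [hη]; ring
  have hlog : η / 2 ≤ Real.log (1 + η) := by
    have h := Real.one_sub_inv_le_log_of_pos (by linarith : 0 < 1 + η)
    have h2 : η / 2 ≤ 1 - (1 + η)⁻¹ := by
      have : 1 - (1 + η)⁻¹ = η / (1 + η) := by field_simp; ring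
      rw [this]
      gcongr
      linarith
    linarith
  have hu : (2 : ℝ) ≤ 4 * n / ε := by
    rw [le_div_iff₀ hε]; nlinarith
  -- With u = 4n/ε ≥ 2, n/η² ≤ 196u² ≤ 2⁸u² ≤ u¹⁰.
  have hnum : Real.log (n / η ^ 2) ≤ 10 * Real.log (4 * n / ε) := by
    have h10 : (10 : ℝ) * Real.log (4 * n / ε) = Real.log ((4 * n / ε) ^ 10) := by
      rw [Real.log_pow]; norm_num
    rw [h10]
    apply Real.log_le_log (by positivity)
    calc (n : ℝ) / η ^ 2 ≤ n ^ 2 / η ^ 2 := by gcongr; nlinarith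
      _ = 196 * (4 * n / ε) ^ 2 := by rw [hεη]; field_simp; norm_num
      _ ≤ 2 ^ 8 * (4 * n / ε) ^ 2 := by gcongr; norm_num
      _ ≤ (4 * n / ε) ^ 8 * (4 * n / ε) ^ 2 := by gcongr
      _ = _ := by ring
  have hnum0 : 0 ≤ Real.log (n / η ^ 2) := by
    apply Real.log_nonneg
    rw [le_div_iff₀ (by positivity)]
    nlinarith
  rw [← hη]
  have hceil : (numBuckets n η : ℝ) ≤ Real.log (n / η ^ 2) / Real.log (1 + η) + 2 := by
    have := Nat.ceil_lt_add_one (div_nonneg hnum0 (by linarith : 0 ≤ Real.log (1 + η)))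
    unfold numBuckets
    push_cast
    linarith
  calc (numBuckets n η : ℝ) ≤ Real.log (n / η ^ 2) / Real.log (1 + η) + 2 := hceil
    _ ≤ 10 * Real.log (4 * n / ε) / (η / 2) + 2 := by gcongr
    _ = 1120 * Real.log (4 * n / ε) / ε + 2 := by
        rw [hη]; field_simp; ring
    _ ≤ 1120 * Real.log (4 * n / ε) / ε + 8 * Real.log (4 * n / ε) / ε := by
        gcongr
        rw [le_div_iff₀ hε]
        linarith
    _ = _ := by ring

lemma numSamples_le (hn : 1 ≤ n) (hk : 1 ≤ k) (hε : 0 < ε) (hε2 : ε ≤ 2) :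
    ((numBatches 10 n ε * batchSize (10 ^ 9) n k ε : ℕ) : ℝ) ≤
      10 ^ 12 * (√((n : ℝ) * k) / ε ^ (3.5 : ℝ)) * Real.log (4 * n / ε) ^ 2 := by
  have hl := half_le_log hn hε hε2
  have hv := numBuckets_le hn hε hε2
  have hsq := one_le_sqrt_mul_numCells (ε := ε) hn hk
  have hc := cube_le hε hε2
  have hpow : ε ^ (3.5 : ℝ) = ε ^ 3 * √ε := by
    rw [Real.sqrt_eq_rpow, ← Real.rpow_natCast, ← Real.rpow_add hε]
    norm_num
  have hR : (numBatches 10 n ε : ℝ) ≤ 12 * Real.log (4 * n / ε) := by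
    have := Nat.ceil_lt_add_one (by linarith : 0 ≤ 10 * Real.log (4 * n / ε))
    unfold numBatches
    linarith
  have hm : (batchSize (10 ^ 9) n k ε : ℝ) ≤
      (10 ^ 9 + 8) * √((n : ℝ) * numCells n k ε) / ε ^ 3 := by
    have h0 : 0 ≤ 10 ^ 9 * √((n : ℝ) * numCells n k ε) / ε ^ 3 := by positivity
    have h1 : (batchSize (10 ^ 9) n k ε : ℝ) < 10 ^ 9 * √((n : ℝ) * numCells n k ε) / ε ^ 3 + 1 :=
      Nat.ceil_lt_add_one h0
    have h2 : 1 ≤ 8 * √((n : ℝ) * numCells n k ε) / ε ^ 3 := by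
      rw [le_div_iff₀ (by positivity)]
      linarith
    calc (batchSize (10 ^ 9) n k ε : ℝ)
        ≤ 10 ^ 9 * √((n : ℝ) * numCells n k ε) / ε ^ 3 +
          8 * √((n : ℝ) * numCells n k ε) / ε ^ 3 := by linarith
      _ = _ := by ring
  have hcell : √((n : ℝ) * numCells n k ε) ≤
      √((n : ℝ) * k) * (68 * Real.log (4 * n / ε) / √ε) := by
    have h1 : (n : ℝ) * numCells n k ε ≤ n * k * (1128 * Real.log (4 * n / ε) / ε) := by
      unfold numCells
      push_cast
      rw [← mul_assoc]
      gcongr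
    refine (Real.sqrt_le_sqrt h1).trans ?_
    rw [Real.sqrt_mul (by positivity), Real.sqrt_div (by positivity)]
    gcongr
    -- The logarithm ℓ is at least 1/2, so 1128ℓ ≤ (68ℓ)²; this trades √ℓ for ℓ and leads to the
    -- exponent 2 of the logarithm.
    rw [Real.sqrt_le_left (by positivity)]
    nlinarith
  generalize Real.log (4 * n / ε) = ℓ at *
  have hε' : 0 < √ε := Real.sqrt_pos.mpr hε
  rw [hpow]
  push_cast
  calc (numBatches 10 n ε : ℝ) * batchSize (10 ^ 9) n k ε
      ≤ (12 * ℓ) * ((10 ^ 9 + 8) * (√((n : ℝ) * k) * (68 * ℓ / √ε)) / ε ^ 3) := by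
        refine mul_le_mul hR (hm.trans ?_) (by positivity) (by positivity)
        gcongr
    _ = (12 * (10 ^ 9 + 8) * 68) * (√((n : ℝ) * k) / (ε ^ 3 * √ε)) * ℓ ^ 2 := by
        field_simp
    _ ≤ _ := by
        gcongr
        norm_num

end Parameters

/-! ### The overall shape -/

section Coarse

variable {n k : ℕ} {q : Fin n → ℝ} {η : ℝ}

lemma sum_empirical {s : ℕ} (x : Fin s → Fin n) (A : Finset (Fin n)) :
    ∑ a ∈ A, empirical x a = (countIn x A : ℝ) / s := by
  simp only [empirical, ← Finset.sum_div]
  congr 1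
  simp only [countIn, Finset.card_filter]
  push_cast
  rw [Finset.sum_comm]
  refine Finset.sum_congr rfl fun i _ => ?_
  simp

lemma sum_empirical_univ {s : ℕ} (hs : 0 < s) (x : Fin s → Fin n) :
    ∑ a, empirical x a = 1 := by
  have : (s : ℝ) ≠ 0 := by exact_mod_cast hs.ne'
  rw [sum_empirical]
  simp [countIn, this]

/-- Padding with `none` lets functions on `Fin N` encode all families of at most N runs, so that
they are easy to count. -/
lemma exists_enumeration {β : Type*} (S : Finset β) {N : ℕ} (hS : S.card ≤ N) :
    ∃ u : Fin N → Option β, ∀ b, b ∈ S ↔ ∃ i, u i = some b := by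
  refine ⟨fun i => S.toList[(i : ℕ)]?, fun b => ?_⟩
  rw [← Finset.mem_toList, List.mem_iff_getElem?]
  constructor
  · rintro ⟨i, hi⟩
    have hlt : i < S.toList.length := (List.getElem?_eq_some_iff.mp hi).1
    rw [Finset.length_toList] at hlt
    exact ⟨⟨i, by omega⟩, hi⟩
  · rintro ⟨i, hi⟩
    exact ⟨i, hi⟩

/-- The union of a family of runs. -/
def unionRuns (q : Fin n → ℝ) (η : ℝ) {N : ℕ} (u : Fin N → Option (Fin n × Fin n)) :
    Finset (Fin n) :=
  {z | ∃ i, ∃ ab, u i = some ab ∧ z ∈ run q η ab}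

lemma exists_unionRuns_eq (hη : 0 < η) {I : Segmentation n k} {𝒜 : Finset (Finset (Fin n))}
    (h𝒜 : 𝒜 ⊆ refinedDivision I q η) (hne : ∀ D ∈ 𝒜, D.Nonempty) {N : ℕ} (hN : 𝒜.card ≤ N) :
    ∃ u : Fin N → Option (Fin n × Fin n), unionRuns q η u = 𝒜.biUnion id := by
  have h : ∀ D : 𝒜, ∃ ab, (D : Finset (Fin n)) = run q η ab := fun D =>
    exists_eq_run hη (h𝒜 D.2) (hne D D.2)
  choose ab hab using h
  obtain ⟨u, hu⟩ := exists_enumeration (𝒜.attach.image ab) (N := N)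
    (Finset.card_image_le.trans (by simpa using hN))
  refine ⟨u, ?_⟩
  ext z
  simp only [unionRuns, Finset.mem_filter, Finset.mem_univ, true_and, Finset.mem_biUnion, id]
  constructor
  · rintro ⟨i, c, hc, hz⟩
    obtain ⟨D, -, rfl⟩ := Finset.mem_image.mp ((hu c).mpr ⟨i, hc⟩)
    exact ⟨D, D.2, by rwa [hab D]⟩
  · rintro ⟨D, hD, hz⟩
    obtain ⟨i, hi⟩ := (hu (ab ⟨D, hD⟩)).mp (Finset.mem_image_of_mem _ (Finset.mem_attach _ _))
    exact ⟨i, _, hi, by rwa [← hab ⟨D, hD⟩]⟩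

/-- The empirical distribution is close to `p` on the refined division, if no union of few runs is
overrepresented in the sample. -/
lemma coarseDist_le_of_countIn_lt (hη : 0 < η) (hq : q ∈ stdSimplex ℝ (Fin n))
    {p : Fin n → ℝ} (hp : p ∈ stdSimplex ℝ (Fin n)) {s : ℕ} (hs : 0 < s) {x : Fin s → Fin n}
    {a : ℝ} {N : ℕ} (I : Segmentation n k)
    (hN : Finset.card {D ∈ refinedDivision I q η | D.Nonempty} ≤ N)
    (hx : ∀ u : Fin N → Option (Fin n × Fin n),
      (countIn x (unionRuns q η u) : ℝ) < s * (∑ b ∈ unionRuns q η u, p b + a)) :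
    coarseDist (refinedDivision I q η) (empirical x) p ≤ 2 * a := by
  have hs' : (0 : ℝ) < s := by exact_mod_cast hs
  set 𝒟 := refinedDivision I q η with h𝒟
  set Δ : Finset (Fin n) → ℝ := fun D => ∑ b ∈ D, empirical x b - ∑ b ∈ D, p b with hΔ
  -- The discrepancies sum to 0, so their ℓ₁-norm is twice the sum over the overrepresented sets:
  -- one upper tail, for one union of runs, is enough.
  set 𝒜 := 𝒟.filter fun D => D.Nonempty ∧ 0 ≤ Δ D with h𝒜
  have h𝒜sub : 𝒜 ⊆ 𝒟 := Finset.filter_subset _ _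
  have hdisj : (𝒜 : Set (Finset (Fin n))).PairwiseDisjoint id :=
    (pairwiseDisjoint_refinedDivision hη).subset fun D hD => h𝒜sub hD
  obtain ⟨u, hu⟩ := exists_unionRuns_eq hη h𝒜sub (fun D hD => (Finset.mem_filter.mp hD).2.1)
    (N := N) ((Finset.card_le_card fun D hD => by
      rw [h𝒜, Finset.mem_filter] at hD
      exact Finset.mem_filter.mpr ⟨hD.1, hD.2.1⟩).trans hN)
  have hpos : ∑ D ∈ 𝒜, Δ D < a := by
    have h1 := hx u
    rw [hu, mul_comm, ← div_lt_iff₀ hs', ← sum_empirical, Finset.sum_biUnion hdisj,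
      Finset.sum_biUnion hdisj] at h1
    simp only [hΔ, Finset.sum_sub_distrib]
    simp only [id] at h1
    linarith
  have hzero : ∑ D ∈ 𝒟, Δ D = 0 := by
    simp only [hΔ, Finset.sum_sub_distrib]
    rw [sum_refinedDivision hη hq, sum_refinedDivision hη hq, sum_empirical_univ hs, hp.2, sub_self]
  have habs : ∀ D ∈ 𝒟, |Δ D| = 2 * (if D.Nonempty ∧ 0 ≤ Δ D then Δ D else 0) - Δ D := by
    intro D _
    rcases D.eq_empty_or_nonempty with rfl | hne
    · simp [hΔ]
    · by_cases h : 0 ≤ Δ D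
      · rw [if_pos ⟨hne, h⟩, abs_of_nonneg h]; ring
      · rw [if_neg (fun h' => h h'.2), abs_of_neg (not_le.mp h)]; ring
  calc coarseDist 𝒟 (empirical x) p = ∑ D ∈ 𝒟, |Δ D| := rfl
    _ = ∑ D ∈ 𝒟, (2 * (if D.Nonempty ∧ 0 ≤ Δ D then Δ D else 0) - Δ D) :=
        Finset.sum_congr rfl habs
    _ = 2 * ∑ D ∈ 𝒜, Δ D := by
        rw [Finset.sum_sub_distrib, hzero, ← Finset.mul_sum, sub_zero, h𝒜, Finset.sum_filter]
    _ ≤ 2 * a := by linarith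

variable {ε : ℝ}

/-- With high probability, the empirical distribution is close to `p` on all refined divisions. -/
lemma prob_lt_coarseDist (hk : 1 ≤ k) (hε : 0 < ε) (hε2 : ε ≤ 2) (hq : q ∈ stdSimplex ℝ (Fin n))
    {p : Fin n → ℝ} (hp : p ∈ stdSimplex ℝ (Fin n)) (hn : 1 ≤ n) :
    prob p (fun x : Fin (numBatches 10 n ε * batchSize (10 ^ 9) n k ε) → Fin n =>
      ∃ I : Segmentation n k,
        ε / 14 < coarseDist (refinedDivision I q (ε / 14 / 4)) (empirical x) p) ≤
      Real.exp (-(10 * Real.log (4 * n / ε))) := by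
  have hη : 0 < ε / 14 / 4 := by positivity
  set N := min n (2 * numCells n k ε) with hN
  have hs : 0 < numBatches 10 n ε * batchSize (10 ^ 9) n k ε := by
    exact_mod_cast numSamples_pos hn hk hε hε2
  have hb := pow_mul_exp_le hn hk hε hε2 (N := N) (min_le_left _ _) (min_le_right _ _)
  generalize numBatches 10 n ε * batchSize (10 ^ 9) n k ε = s at *
  -- The unions of runs do not refer to `I`, so this union bound treats all segmentations
  -- simultaneously.
  refine le_trans (prob_mono hp (E' := fun x => ∃ u : Fin N → Option (Fin n × Fin n),
    s * (∑ b ∈ unionRuns q (ε / 14 / 4) u, p b + ε / 14 / 2) ≤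
      countIn x (unionRuns q (ε / 14 / 4) u)) ?_)
    ((prob_exists_le hp _ fun u =>
      prob_add_le_countIn hp _ (by positivity) (by linarith)).trans ?_)
  · rintro x ⟨I, hI⟩
    by_contra hcon
    push Not at hcon
    have := coarseDist_le_of_countIn_lt hη hq hp hs I (N := N) (le_min
      (card_nonempty_refinedDivision_le hη)
      ((Finset.card_filter_le _ _).trans (card_refinedDivision_le hn hη))) hcon
    linarith
  · refine le_trans (le_of_eq ?_) hb
    congr 1
    simp
    ring

end Coarse

/-! ### Majority votes of collision tests -/

section Majority

variable {n R m : ℕ} {p : Fin n → ℝ}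

/-- The batches are R independent samples of the product distribution, so `prob_half_le` applies
with the set of batches on which `E` occurs. The weak inequality also covers ties. -/
lemma prob_majority_le (hp : p ∈ stdSimplex ℝ (Fin n)) {E : (Fin m → Fin n) → Prop}
    (hE : prob p E ≤ 1 / 36) :
    prob p (fun x : Fin (R * m) → Fin n => R ≤ 2 * Finset.card {b | E (batch x b)}) ≤
      (1 / 3 : ℝ) ^ R := by
  rw [prob_batch p (fun z : Fin R → Fin m → Fin n => R ≤ 2 * Finset.card {b | E (z b)})]
  have h := prob_half_le (ι := Fin R) (prod_mem_stdSimplex (ι := Fin m) hp)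
    (A := Finset.univ.filter E) (by rwa [Finset.sum_filter, sum_ite_eq_prob])
  simpa using h

lemma prob_looksNonuniform_le (hp : p ∈ stdSimplex ℝ (Fin n)) {D : Finset (Fin n)} {e : ℝ}
    (h : prob p (fun y : Fin m → Fin n => (2 * e) ^ 2 / (D.card : ℝ) ≤ l2SqEstimate y D) ≤ 1 / 36) :
    prob p (fun x : Fin (R * m) → Fin n => LooksNonuniform e x D) ≤ (1 / 3 : ℝ) ^ R :=
  (prob_mono hp fun x hx => by
    have : R < 2 * Finset.card {b : Fin R | (2 * e) ^ 2 / (D.card : ℝ) ≤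
      l2SqEstimate (batch x b) D} := hx
    convert this.le).trans (prob_majority_le hp h)

lemma prob_not_looksNonuniform_le (hp : p ∈ stdSimplex ℝ (Fin n)) {D : Finset (Fin n)} {e : ℝ}
    (h : prob p (fun y : Fin m → Fin n => l2SqEstimate y D < (2 * e) ^ 2 / (D.card : ℝ)) ≤ 1 / 36) :
    prob p (fun x : Fin (R * m) → Fin n => ¬ LooksNonuniform e x D) ≤ (1 / 3 : ℝ) ^ R :=
  (prob_mono hp fun x hx => by
    have h1 : 2 * Finset.card {b : Fin R | (2 * e) ^ 2 / (D.card : ℝ) ≤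
      l2SqEstimate (batch x b) D} ≤ R := not_lt.mp hx
    have h2 := Finset.card_filter_add_card_filter_not (s := (Finset.univ : Finset (Fin R)))
      (fun b => (2 * e) ^ 2 / (D.card : ℝ) ≤ l2SqEstimate (batch x b) D)
    simp only [not_le, Finset.card_univ, Fintype.card_fin] at h2
    have h3 : R ≤ 2 * Finset.card {b : Fin R | l2SqEstimate (batch x b) D <
      (2 * e) ^ 2 / (D.card : ℝ)} := by omega
    convert h3).trans (prob_majority_le hp h)

end Majority

/-! ### Functions of small oscillation on a set -/

section Oscillation

variable {n : ℕ} {q : Fin n → ℝ} {η : ℝ} {D : Finset (Fin n)}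

lemma abs_sub_average_le {f : Fin n → ℝ} {c : ℝ} (h : ∀ a ∈ D, ∀ b ∈ D, f a - f b ≤ c)
    {a : Fin n} (ha : a ∈ D) : |f a - (∑ b ∈ D, f b) / D.card| ≤ c := by
  have hd : (0 : ℝ) < D.card := by exact_mod_cast Finset.card_pos.mpr ⟨a, ha⟩
  have h1 : D.card * f a - ∑ b ∈ D, f b ≤ D.card * c := by
    calc D.card * f a - ∑ b ∈ D, f b = ∑ b ∈ D, (f a - f b) := by
          rw [Finset.sum_sub_distrib]; simp
      _ ≤ ∑ b ∈ D, c := Finset.sum_le_sum fun b hb => h a ha b hb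
      _ = D.card * c := by simp
  have h2 : ∑ b ∈ D, f b - D.card * f a ≤ D.card * c := by
    calc ∑ b ∈ D, f b - D.card * f a = ∑ b ∈ D, (f b - f a) := by
          rw [Finset.sum_sub_distrib]; simp
      _ ≤ ∑ b ∈ D, c := Finset.sum_le_sum fun b hb => h b hb a ha
      _ = D.card * c := by simp
  have h3 : f a - (∑ b ∈ D, f b) / D.card = (D.card * f a - ∑ b ∈ D, f b) / D.card := by
    field_simp
  rw [h3, abs_le, le_div_iff₀ hd, div_le_iff₀ hd]
  constructor <;> linarith

/-- The difference is at most η f(b), and f(b) is at most 1 + η ≤ 2 times the average. -/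
lemma sub_le_of_le_one_add_mul {f : Fin n → ℝ} (hη : 0 ≤ η) (hη1 : η ≤ 1) (hf : ∀ a, 0 ≤ f a)
    (h : ∀ a ∈ D, ∀ b ∈ D, f a ≤ (1 + η) * f b) :
    ∀ a ∈ D, ∀ b ∈ D, f a - f b ≤ 2 * η * ((∑ c ∈ D, f c) / D.card) := by
  intro a ha b hb
  have hd : (0 : ℝ) < D.card := by exact_mod_cast Finset.card_pos.mpr ⟨a, ha⟩
  have h1 : f b ≤ (1 + η) * ((∑ c ∈ D, f c) / D.card) := by
    rw [← mul_div_assoc, le_div_iff₀ hd]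
    calc f b * D.card = ∑ c ∈ D, f b := by simp [mul_comm]
      _ ≤ ∑ c ∈ D, (1 + η) * f c := Finset.sum_le_sum fun c hc => h b hb c hc
      _ = (1 + η) * ∑ c ∈ D, f c := by rw [Finset.mul_sum]
  have h2 : 0 ≤ (∑ c ∈ D, f c) / D.card := div_nonneg (Finset.sum_nonneg fun c _ => hf c) hd.le
  have h3 := h a ha b hb
  have h4 : η * f b ≤ η * (2 * ((∑ c ∈ D, f c) / D.card)) := by
    refine mul_le_mul_of_nonneg_left (h1.trans ?_) hη
    gcongr
    linarith
  linarith

lemma oscillation_of_subset_bucket (hη : 0 < η) (hq : ∀ a, 0 ≤ q a) {j : ℕ}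
    (hD : D ⊆ bucket q η j) :
    (∀ a ∈ D, ∀ b ∈ D, q a - q b ≤ η ^ 2 / n) ∨ ∀ a ∈ D, ∀ b ∈ D, q a ≤ (1 + η) * q b := by
  cases j with
  | zero =>
    left
    intro a ha b _
    have h := hD ha
    simp only [bucket, Finset.mem_filter] at h
    linarith [h.2, hq b]
  | succ j =>
    right
    intro a ha b hb
    have h1 := hD ha
    have h2 := hD hb
    simp only [bucket, Finset.mem_filter] at h1 h2
    calc q a ≤ (1 + η) ^ (j + 1) * η ^ 2 / n := h1.2.2
      _ = (1 + η) * ((1 + η) ^ j * η ^ 2 / n) := by ring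
      _ ≤ (1 + η) * q b := by
          have := h2.2.1.le
          gcongr

end Oscillation

/-! ### Completeness -/

section Completeness

variable {n k : ℕ} {q r : Fin n → ℝ} {ε α : ℝ} {I : Segmentation n k}

lemma mixture_mem_stdSimplex (hq : q ∈ stdSimplex ℝ (Fin n)) (hr : r ∈ stdSimplex ℝ (Fin n))
    (hα : α ∈ Set.Icc (0 : ℝ) 1) : mixture α q r ∈ stdSimplex ℝ (Fin n) := by
  refine ⟨fun a => ?_, ?_⟩
  · have h0 := hα.1
    have h1 : 0 ≤ 1 - α := by linarith [hα.2]
    have := hq.1 a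
    have := hr.1 a
    unfold mixture
    positivity
  · simp only [mixture, Finset.sum_add_distrib, ← Finset.mul_sum, hq.2, hr.2]
    ring

/-- A mixture of `q` and a flat distribution is nearly uniform on the sets of the refined
division that are not too light. -/
lemma mixture_near_uniform (hk : 1 ≤ k) (hε : 0 < ε) (hε2 : ε ≤ 2)
    (hq : q ∈ stdSimplex ℝ (Fin n)) (hr : r ∈ stdSimplex ℝ (Fin n)) (hI : I.IsFlatOn r)
    (hα : α ∈ Set.Icc (0 : ℝ) 1) {D : Finset (Fin n)}
    (hD : D ∈ refinedDivision I q (ε / 14 / 4))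
    (hdt : (D.card : ℝ) * numCells n k ε ≤ 2 * n)
    (hP : ε / 14 / (8 * numCells n k ε) ≤ ∑ b ∈ D, mixture α q r b) :
    ∀ a ∈ D, |mixture α q r a - (∑ b ∈ D, mixture α q r b) / D.card| ≤
      ε / 14 * ((∑ b ∈ D, mixture α q r b) / D.card) := by
  intro a ha
  refine abs_sub_average_le ?_ ha
  obtain ⟨i, j, hDi, hDj⟩ := exists_subset_of_mem_refinedDivision hD
  have hd : (0 : ℝ) < D.card := by exact_mod_cast Finset.card_pos.mpr ⟨a, ha⟩
  have hn : (0 : ℝ) < n := by exact_mod_cast Fin.pos a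
  have hα0 := hα.1
  have hα1 : 0 ≤ 1 - α := by linarith [hα.2]
  have hp := mixture_mem_stdSimplex hq hr hα
  have ht : (1 : ℝ) ≤ numCells n k ε := by exact_mod_cast numCells_pos hk
  have hflat : ∀ a ∈ D, ∀ b ∈ D, r a = r b := fun a ha b hb => hI i a (hDi ha) b (hDi hb)
  have hη : 0 < ε / 14 / 4 := by positivity
  rcases oscillation_of_subset_bucket hη hq.1 hDj with h | h
  · intro a ha b hb
    have h1 : mixture α q r a - mixture α q r b = (1 - α) * (q a - q b) := by
      unfold mixture
      rw [hflat a ha b hb]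
      ring
    rw [h1]
    have h2 : (1 - α) * (q a - q b) ≤ (ε / 14 / 4) ^ 2 / n := by
      have h3 : (1 - α) * (q a - q b) ≤ (1 - α) * ((ε / 14 / 4) ^ 2 / n) :=
        mul_le_mul_of_nonneg_left (h a ha b hb) hα1
      have h4 : 0 ≤ α * ((ε / 14 / 4) ^ 2 / n) := by positivity
      linarith
    refine h2.trans ?_
    -- The value η = ε'/4 is matched to this step: the average on `D` is at least ε'/(8t|D|) ≥
    -- ε'/(16n), so η²/n is at most ε' times the average.
    calc (ε / 14 / 4) ^ 2 / n = (ε / 14) ^ 2 / (8 * (2 * n)) := by field_simp; norm_num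
      _ ≤ (ε / 14) ^ 2 / (8 * (D.card * numCells n k ε)) := by gcongr
      _ = ε / 14 * (ε / 14 / (8 * numCells n k ε) / D.card) := by field_simp
      _ ≤ _ := by gcongr
  · intro a ha b hb
    have h1 := sub_le_of_le_one_add_mul (f := mixture α q r) hη.le (by linarith) hp.1
      (fun a ha b hb => by
        have h2 : (1 - α) * q a ≤ (1 - α) * ((1 + ε / 14 / 4) * q b) :=
          mul_le_mul_of_nonneg_left (h a ha b hb) hα1
        have h3 : 0 ≤ ε / 14 / 4 * (α * r b) :=
          mul_nonneg hη.le (mul_nonneg hα0 (hr.1 b))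
        unfold mixture
        rw [hflat a ha b hb]
        linarith) a ha b hb
    refine h1.trans ?_
    gcongr
    · exact div_nonneg (Finset.sum_nonneg fun b _ => hp.1 b) hd.le
    · linarith

/-- A set of the refined division is unlikely to be heavy in the sample and yet fail the
uniformity test. -/
lemma prob_heavy_looksNonuniform_le (hn : 1 ≤ n) (hk : 1 ≤ k) (hε : 0 < ε) (hε2 : ε ≤ 2)
    (hq : q ∈ stdSimplex ℝ (Fin n)) (hr : r ∈ stdSimplex ℝ (Fin n)) (hI : I.IsFlatOn r)
    (hα : α ∈ Set.Icc (0 : ℝ) 1) {D : Finset (Fin n)}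
    (hD : D ∈ refinedDivision I q (ε / 14 / 4)) (hD2 : 2 ≤ D.card) :
    prob (mixture α q r)
      (fun x : Fin (numBatches 10 n ε * batchSize (10 ^ 9) n k ε) → Fin n =>
        ε / 14 * ((numBatches 10 n ε * batchSize (10 ^ 9) n k ε : ℕ) : ℝ) /
          (4 * numCells n k ε) ≤ (countIn x D : ℝ) ∧ LooksNonuniform (ε / 14) x D) ≤
      Real.exp (-(10 * Real.log (4 * n / ε))) := by
  have hp := mixture_mem_stdSimplex hq hr hα
  obtain ⟨htn, hdt⟩ := card_le_of_mem_refinedDivision hk hD hD2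
  have ht : (1 : ℝ) ≤ numCells n k ε := by exact_mod_cast numCells_pos hk
  have ht0 : (0 : ℝ) < numCells n k ε := by linarith
  -- Either the mass suffices for the collision test, or the threshold ε's/(4t) is more than twice
  -- the expected count.
  rcases le_or_gt (ε / 14 / (8 * numCells n k ε)) (∑ b ∈ D, mixture α q r b) with hP | hP
  · have hu := mixture_near_uniform hk hε hε2 hq hr hI hα hD hdt hP
    have hmP := le_batchSize_mul hk hε (Nat.cast_nonneg _) hdt hP
    refine (prob_mono hp fun x hx => hx.2).trans
      ((prob_looksNonuniform_le hp ?_).trans (one_third_pow_le n ε))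
    exact prob_le_estimate_of_near_uniform hp (by positivity) (by linarith) hD2
      (lt_of_lt_of_le (by positivity) hP) (two_le_batchSize hn hk hε hε2) hmP hu
  · refine (prob_mono hp fun x hx => hx.1).trans
      ((prob_le_countIn hp D ?_).trans (exp_threshold_le hn hk hε hε2 htn le_rfl))
    calc _ ≤ ((numBatches 10 n ε * batchSize (10 ^ 9) n k ε : ℕ) : ℝ) *
          (ε / 14 / (8 * numCells n k ε)) := by gcongr
      _ = _ := by ring

/-- On a singleton all pairs collide, so the estimate is 0, or -1 if there is no pair. Singletons
therefore need no lower bound on their mass. -/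
lemma not_looksNonuniform_of_card_eq_one {R m : ℕ} {x : Fin (R * m) → Fin n}
    {D : Finset (Fin n)} {e : ℝ} (he : 0 < e) (hD : D.card = 1) : ¬ LooksNonuniform e x D := by
  unfold LooksNonuniform
  have : ∀ b : Fin R, ¬ (2 * e) ^ 2 / (D.card : ℝ) ≤ l2SqEstimate (batch x b) D := by
    intro b hb
    have h1 := collisions_le_choose (batch x b) D
    have h2 : (collisions (batch x b) D : ℝ) / (countIn (batch x b) D).choose 2 ≤ 1 :=
      div_le_one_of_le₀ h1 (by positivity)
    rw [l2SqEstimate, hD] at hb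
    have h3 : 0 < (2 * e) ^ 2 := by positivity
    norm_num at hb
    linarith
  simp [this]

lemma exists_alphaGrid_near {e : ℝ} (he : 0 < e) (hα : α ∈ Set.Icc (0 : ℝ) 1) :
    ∃ β ∈ alphaGrid e, |α - β| < e / 2 := by
  refine ⟨(⌊α / (e / 2)⌋₊ : ℝ) * (e / 2), Or.inr ⟨?_, _, rfl⟩, ?_⟩
  · have h := Nat.floor_le (div_nonneg hα.1 (by positivity : 0 ≤ e / 2))
    rw [le_div_iff₀ (by positivity)] at h
    linarith [hα.2]
  · have h := Nat.floor_le (div_nonneg hα.1 (by positivity : 0 ≤ e / 2))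
    rw [le_div_iff₀ (by positivity)] at h
    have h2 := Nat.lt_floor_add_one (α / (e / 2))
    rw [div_lt_iff₀ (by positivity)] at h2
    rw [abs_lt]
    constructor <;> linarith

lemma coarseDist_triangle (𝒟 : Finset (Finset (Fin n))) (f g h : Fin n → ℝ) :
    coarseDist 𝒟 f h ≤ coarseDist 𝒟 f g + coarseDist 𝒟 g h := by
  unfold coarseDist
  rw [← Finset.sum_add_distrib]
  exact Finset.sum_le_sum fun D _ => abs_sub_le _ _ _

lemma coarseDist_comm (𝒟 : Finset (Finset (Fin n))) (f g : Fin n → ℝ) :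
    coarseDist 𝒟 f g = coarseDist 𝒟 g f :=
  Finset.sum_congr rfl fun _ _ => abs_sub_comm _ _

lemma coarseDist_le_l1Dist {η : ℝ} (hη : 0 < η) (hq : q ∈ stdSimplex ℝ (Fin n))
    (f g : Fin n → ℝ) : coarseDist (refinedDivision I q η) f g ≤ l1Dist f g := by
  unfold l1Dist
  rw [← sum_refinedDivision (I := I) hη hq]
  refine Finset.sum_le_sum fun D _ => ?_
  rw [← Finset.sum_sub_distrib]
  exact Finset.abs_sum_le_sum_abs _ _

lemma l1Dist_mixture_le (hq : q ∈ stdSimplex ℝ (Fin n)) (hr : r ∈ stdSimplex ℝ (Fin n))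
    (α β : ℝ) : l1Dist (mixture α q r) (mixture β q r) ≤ 2 * |α - β| := by
  calc l1Dist (mixture α q r) (mixture β q r) ≤ ∑ a, |α - β| * (q a + r a) := by
        refine Finset.sum_le_sum fun a _ => ?_
        have : mixture α q r a - mixture β q r a = (α - β) * (r a - q a) := by
          unfold mixture; ring
        rw [this, abs_mul]
        gcongr
        have h1 := hq.1 a
        have h2 := hr.1 a
        rw [abs_le]
        constructor <;> linarith
    _ = 2 * |α - β| := by
        rw [← Finset.mul_sum, Finset.sum_add_distrib, hq.2, hr.2]
        ring

/-- The tester accepts mixtures of `q` and flat distributions. -/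
lemma completeness (hn : 1 ≤ n) (hk : 1 ≤ k) (hε : 0 < ε) (hε2 : ε ≤ 2)
    (hq : q ∈ stdSimplex ℝ (Fin n)) {p : Fin n → ℝ} (hp : IsMixtureWithFlat k q p) :
    2 / 3 ≤ prob p (Accepts k ε q (numBatches 10 n ε) (batchSize (10 ^ 9) n k ε)) := by
  obtain ⟨r, ⟨hr, I, hI⟩, α, hα, rfl⟩ := hp
  have hp := mixture_mem_stdSimplex hq hr hα
  have hη : 0 < ε / 14 / 4 := by positivity
  have ht : (1 : ℝ) ≤ numCells n k ε := by exact_mod_cast numCells_pos hk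
  have hs := numSamples_pos hn hk hε hε2
  -- Only the segmentation on which `r` is flat has to pass. Its sets are indexed by their end
  -- points; other pairs contribute an empty event.
  have hfail := prob_exists_le hp
    (fun (ab : Fin n × Fin n)
      (x : Fin (numBatches 10 n ε * batchSize (10 ^ 9) n k ε) → Fin n) =>
      (run q (ε / 14 / 4) ab ∈ refinedDivision I q (ε / 14 / 4) ∧
        2 ≤ (run q (ε / 14 / 4) ab).card) ∧
      ε / 14 * ((numBatches 10 n ε * batchSize (10 ^ 9) n k ε : ℕ) : ℝ) /
          (4 * numCells n k ε) ≤ (countIn x (run q (ε / 14 / 4) ab) : ℝ) ∧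
        LooksNonuniform (ε / 14) x (run q (ε / 14 / 4) ab))
    (b := Real.exp (-(10 * Real.log (4 * n / ε)))) fun ab => by
      by_cases h : run q (ε / 14 / 4) ab ∈ refinedDivision I q (ε / 14 / 4) ∧
        2 ≤ (run q (ε / 14 / 4) ab).card
      · exact (prob_mono hp fun x hx => hx.2).trans
          (prob_heavy_looksNonuniform_le hn hk hε hε2 hq hr hI hα h.1 h.2)
      · simp only [h, false_and]
        simp only [prob, if_false, expect_const hp]
        positivity
  have hcoarse := prob_lt_coarseDist hk hε hε2 hq hp hn
  have hexp := exp_neg_log_le hn hε hε2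
  have hn1 : (1 : ℝ) ≤ (n : ℝ) ^ 2 := one_le_pow₀ (by exact_mod_cast hn)
  have hbound : prob (mixture α q r) (fun x =>
      ¬ Accepts k ε q (numBatches 10 n ε) (batchSize (10 ^ 9) n k ε) x) ≤ 1 / 3 := by
    refine (prob_mono hp ?_).trans ((prob_or_le hp _ _).trans
      ((add_le_add hfail hcoarse).trans ?_))
    · intro x hx
      by_contra hcon
      rw [not_or] at hcon
      obtain ⟨hc1, hc2⟩ := hcon
      push Not at hc1 hc2
      refine hx ⟨I, fun D hD hcount hlook => ?_, ?_⟩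
      · have hcount' : ε / 14 * ((numBatches 10 n ε * batchSize (10 ^ 9) n k ε : ℕ) : ℝ) /
          (4 * numCells n k ε) ≤ (countIn x D : ℝ) := hcount
        have hpos : (0 : ℝ) < countIn x D := lt_of_lt_of_le (by positivity) hcount'
        have hne : D.Nonempty := by
          rw [Finset.nonempty_iff_ne_empty]
          rintro rfl
          simp [countIn] at hpos
        rcases Nat.lt_or_ge D.card 2 with h2 | h2
        · have h1 : D.card = 1 := by
            have := Finset.card_pos.mpr hne
            omega
          exact not_looksNonuniform_of_card_eq_one (by positivity) h1 hlook
        · obtain ⟨ab, rfl⟩ := exists_eq_run hη hD hne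
          exact hc1 ab ⟨hD, h2⟩ hcount' hlook
      · obtain ⟨β, hβ, hαβ⟩ := exists_alphaGrid_near (by positivity : 0 < ε / 14) hα
        refine ⟨β, hβ, r, hr.1, hI, ?_⟩
        -- The sampling error is at most ε' and rounding α costs 2|α - β| < ε', together less than
        -- 2ε'.
        have h1 := hc2 I
        have h2 := coarseDist_triangle (refinedDivision I q (ε / 14 / 4)) (empirical x)
          (mixture α q r) (mixture β q r)
        have h3 := coarseDist_le_l1Dist (I := I) hη hq (mixture α q r) (mixture β q r)
        have h4 := l1Dist_mixture_le hq hr α β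
        change coarseDist (refinedDivision I q (ε / 14 / 4)) _ _ < 2 * (ε / 14)
        linarith
    · rw [Fintype.card_prod, Fintype.card_fin, Nat.cast_mul, ← sq]
      have : 1 * Real.exp (-(10 * Real.log (4 * n / ε))) ≤
        (n : ℝ) ^ 2 * Real.exp (-(10 * Real.log (4 * n / ε))) := by gcongr
      linarith
  have := prob_not hp (Accepts k ε q (numBatches 10 n ε) (batchSize (10 ^ 9) n k ε))
  linarith

end Completeness

/-! ### Soundness -/

section Soundness

variable {n k : ℕ} {q p : Fin n → ℝ} {ε α : ℝ} {I : Segmentation n k}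

lemma sum_abs_sub_average_le_two_mul {D : Finset (Fin n)} {f : Fin n → ℝ} (hf : ∀ a, 0 ≤ f a) :
    ∑ a ∈ D, |f a - (∑ b ∈ D, f b) / D.card| ≤ 2 * ∑ b ∈ D, f b := by
  have h0 : 0 ≤ ∑ b ∈ D, f b := Finset.sum_nonneg fun b _ => hf b
  rcases D.eq_empty_or_nonempty with rfl | hne
  · simp
  have hd : (0 : ℝ) < D.card := by exact_mod_cast Finset.card_pos.mpr hne
  calc ∑ a ∈ D, |f a - (∑ b ∈ D, f b) / D.card|
      ≤ ∑ a ∈ D, (f a + (∑ b ∈ D, f b) / D.card) := Finset.sum_le_sum fun a _ => by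
        have h1 := hf a
        have h2 : 0 ≤ (∑ b ∈ D, f b) / D.card := by positivity
        rw [abs_le]
        constructor <;> linarith
    _ = 2 * ∑ b ∈ D, f b := by
        rw [Finset.sum_add_distrib, Finset.sum_const, nsmul_eq_mul]
        field_simp
        ring

/-- The Cauchy–Schwarz inequality; it converts the ℓ₂-guarantee of the collision test into an
ℓ₁-bound. -/
lemma sum_abs_le_of_sum_sq_le {D : Finset (Fin n)} {f : Fin n → ℝ} {c : ℝ} (hc : 0 ≤ c)
    (h : ∑ a ∈ D, f a ^ 2 ≤ c ^ 2 / D.card) : ∑ a ∈ D, |f a| ≤ c := by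
  rcases D.eq_empty_or_nonempty with rfl | hne
  · simpa using hc
  have hd : (0 : ℝ) < D.card := by exact_mod_cast Finset.card_pos.mpr hne
  refine le_of_sq_le_sq ?_ hc
  calc (∑ a ∈ D, |f a|) ^ 2 ≤ D.card * ∑ a ∈ D, |f a| ^ 2 := sq_sum_le_card_mul_sum_sq
    _ = D.card * ∑ a ∈ D, f a ^ 2 := by simp only [sq_abs]
    _ ≤ D.card * (c ^ 2 / D.card) := by gcongr
    _ = c ^ 2 := by field_simp

/-- If the heavy sets of the refined division are nearly uniform, then `p` is close to its
flattening. -/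
lemma sum_abs_sub_average_refinedDivision_le (hn : 1 ≤ n) (hk : 1 ≤ k) (hε : 0 < ε)
    (hq : q ∈ stdSimplex ℝ (Fin n)) (hp : p ∈ stdSimplex ℝ (Fin n))
    (h : ∀ D ∈ refinedDivision I q (ε / 14 / 4), 2 ≤ D.card →
      ε / 14 / numCells n k ε ≤ ∑ a ∈ D, p a →
      ∑ a ∈ D, (p a - (∑ b ∈ D, p b) / D.card) ^ 2 ≤
        9 * (ε / 14) ^ 2 * (∑ a ∈ D, p a) ^ 2 / D.card) :
    ∑ D ∈ refinedDivision I q (ε / 14 / 4), ∑ a ∈ D, |p a - (∑ b ∈ D, p b) / D.card| ≤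
      7 * (ε / 14) := by
  have ht : (1 : ℝ) ≤ numCells n k ε := by exact_mod_cast numCells_pos hk
  have hη : 0 < ε / 14 / 4 := by positivity
  have hcard : ((refinedDivision I q (ε / 14 / 4)).card : ℝ) ≤ 2 * numCells n k ε := by
    exact_mod_cast card_refinedDivision_le hn hη
  -- Heavy sets cost 3ε' p(D), in total 3ε'; light ones cost at most 2ε'/t each, in total 4ε', as
  -- there are at most 2t sets. A heavy singleton costs nothing.
  have hD : ∀ D ∈ refinedDivision I q (ε / 14 / 4),
      ∑ a ∈ D, |p a - (∑ b ∈ D, p b) / D.card| ≤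
        3 * (ε / 14) * (∑ a ∈ D, p a) + 2 * (ε / 14 / numCells n k ε) := by
    intro D hD
    have hP : 0 ≤ ∑ a ∈ D, p a := Finset.sum_nonneg fun a _ => hp.1 a
    have h1 : 0 ≤ ε / 14 / numCells n k ε := by positivity
    have h2 : 0 ≤ 3 * (ε / 14) * ∑ a ∈ D, p a := by positivity
    rcases lt_or_ge (∑ a ∈ D, p a) (ε / 14 / numCells n k ε) with hlight | hheavy
    · have := sum_abs_sub_average_le_two_mul (D := D) hp.1
      linarith
    · rcases Nat.lt_or_ge D.card 2 with hc | hc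
      · have hz : ∑ a ∈ D, |p a - (∑ b ∈ D, p b) / D.card| = 0 := by
          refine Finset.sum_eq_zero fun a ha => ?_
          obtain ⟨c, rfl⟩ := Finset.card_eq_one.mp
            (by have := Finset.card_pos.mpr ⟨a, ha⟩; omega : D.card = 1)
          rw [Finset.mem_singleton.mp ha]
          simp
        rw [hz]
        linarith
      · have := sum_abs_le_of_sum_sq_le h2 ((h D hD hc hheavy).trans (le_of_eq (by ring)))
        linarith
  calc _ ≤ ∑ D ∈ refinedDivision I q (ε / 14 / 4),
        (3 * (ε / 14) * (∑ a ∈ D, p a) + 2 * (ε / 14 / numCells n k ε)) := Finset.sum_le_sum hD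
    _ = 3 * (ε / 14) + (refinedDivision I q (ε / 14 / 4)).card *
          (2 * (ε / 14 / numCells n k ε)) := by
        rw [Finset.sum_add_distrib, ← Finset.mul_sum, sum_refinedDivision hη hq, hp.2]
        simp
    _ ≤ 3 * (ε / 14) + 2 * numCells n k ε * (2 * (ε / 14 / numCells n k ε)) := by gcongr
    _ = 7 * (ε / 14) := by field_simp; norm_num

/-- `q` is close to its flattening. -/
lemma sum_abs_sub_average_bucket_le {η : ℝ} (hn : 1 ≤ n) (hη : 0 < η) (hη1 : η ≤ 1)
    (hq : q ∈ stdSimplex ℝ (Fin n)) :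
    ∑ D ∈ refinedDivision I q η, ∑ a ∈ D, |q a - (∑ b ∈ D, q b) / D.card| ≤ 3 * η := by
  have hn' : (0 : ℝ) < n := by exact_mod_cast hn
  have hD : ∀ D ∈ refinedDivision I q η, ∑ a ∈ D, |q a - (∑ b ∈ D, q b) / D.card| ≤
      ∑ a ∈ D, (η ^ 2 / n + 2 * η * q a) := by
    intro D hD
    obtain ⟨i, j, -, hDj⟩ := exists_subset_of_mem_refinedDivision hD
    rw [Finset.sum_add_distrib, ← Finset.mul_sum, Finset.sum_const, nsmul_eq_mul]
    have hQ : 0 ≤ ∑ a ∈ D, q a := Finset.sum_nonneg fun a _ => hq.1 a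
    rcases oscillation_of_subset_bucket hη hq.1 hDj with h | h
    · calc ∑ a ∈ D, |q a - (∑ b ∈ D, q b) / D.card| ≤ ∑ a ∈ D, η ^ 2 / n :=
            Finset.sum_le_sum fun a ha => abs_sub_average_le h ha
        _ = D.card * (η ^ 2 / n) := by simp
        _ ≤ _ := by
            have : 0 ≤ 2 * η * ∑ a ∈ D, q a := by positivity
            linarith
    · have h' := sub_le_of_le_one_add_mul hη.le hη1 hq.1 h
      calc ∑ a ∈ D, |q a - (∑ b ∈ D, q b) / D.card|
          ≤ ∑ a ∈ D, 2 * η * ((∑ c ∈ D, q c) / D.card) :=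
            Finset.sum_le_sum fun a ha => abs_sub_average_le h' ha
        _ = 2 * η * (D.card * ((∑ c ∈ D, q c) / D.card)) := by
            rw [Finset.sum_const, nsmul_eq_mul]; ring
        _ ≤ 2 * η * ∑ c ∈ D, q c := by
            gcongr
            rw [← mul_div_assoc, mul_comm]
            exact div_le_of_le_mul₀ (by positivity) hQ le_rfl
        _ ≤ _ := by
            have : 0 ≤ (D.card : ℝ) * (η ^ 2 / n) := by positivity
            linarith
  calc _ ≤ ∑ D ∈ refinedDivision I q η, ∑ a ∈ D, (η ^ 2 / n + 2 * η * q a) :=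
        Finset.sum_le_sum hD
    _ = η ^ 2 + 2 * η := by
        rw [sum_refinedDivision hη hq, Finset.sum_add_distrib, ← Finset.mul_sum, hq.2]
        simp
        field_simp
    _ ≤ 3 * η := by nlinarith

/-- Averages over a set of the refined division only change the `q`-part of a mixture. -/
lemma sum_abs_sub_average_mixture_le (hα : α ∈ Set.Icc (0 : ℝ) 1) {f : Fin n → ℝ}
    {D : Finset (Fin n)} (hf : ∀ a ∈ D, ∀ b ∈ D, f a = f b) :
    ∑ a ∈ D, |mixture α q f a - (∑ b ∈ D, mixture α q f b) / D.card| ≤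
      ∑ a ∈ D, |q a - (∑ b ∈ D, q b) / D.card| := by
  refine Finset.sum_le_sum fun a ha => ?_
  have hd : (D.card : ℝ) ≠ 0 := by exact_mod_cast (Finset.card_pos.mpr ⟨a, ha⟩).ne'
  have hsum : ∑ b ∈ D, f b = D.card * f a := by
    rw [Finset.sum_congr rfl fun b hb => hf b hb a ha]
    simp
  have : mixture α q f a - (∑ b ∈ D, mixture α q f b) / D.card =
      (1 - α) * (q a - (∑ b ∈ D, q b) / D.card) := by
    simp only [mixture, Finset.sum_add_distrib, ← Finset.mul_sum, hsum]
    field_simp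
    ring
  rw [this, abs_mul, abs_of_nonneg (by linarith [hα.2] : 0 ≤ 1 - α)]
  exact mul_le_of_le_one_left (abs_nonneg _) (by linarith [hα.1])

/-- The triangle inequality through the two flattenings, whose ℓ₁-distance on a set is the
difference of the masses. -/
lemma l1Dist_le_of_refinedDivision {η : ℝ} (hη : 0 < η) (hq : q ∈ stdSimplex ℝ (Fin n))
    (f g : Fin n → ℝ) :
    l1Dist f g ≤
      ∑ D ∈ refinedDivision I q η, ∑ a ∈ D, |f a - (∑ b ∈ D, f b) / D.card| +
      coarseDist (refinedDivision I q η) f g +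
      ∑ D ∈ refinedDivision I q η, ∑ a ∈ D, |g a - (∑ b ∈ D, g b) / D.card| := by
  unfold l1Dist coarseDist
  rw [← sum_refinedDivision (I := I) hη hq, ← Finset.sum_add_distrib, ← Finset.sum_add_distrib]
  refine Finset.sum_le_sum fun D _ => ?_
  set F := ∑ b ∈ D, f b
  set G := ∑ b ∈ D, g b
  calc ∑ a ∈ D, |f a - g a|
      ≤ ∑ a ∈ D, (|f a - F / D.card| + |F - G| / D.card + |g a - G / D.card|) := by
        refine Finset.sum_le_sum fun a _ => ?_
        have h1 : f a - g a = (f a - F / D.card) + (F - G) / D.card + -(g a - G / D.card) := by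
          ring
        rw [h1]
        refine (abs_add_three _ _ _).trans (le_of_eq ?_)
        rw [abs_neg, abs_div, Nat.abs_cast]
    _ ≤ _ := by
        rw [Finset.sum_add_distrib, Finset.sum_add_distrib, Finset.sum_const, nsmul_eq_mul]
        gcongr
        rw [← mul_div_assoc, mul_comm]
        exact div_le_of_le_mul₀ (by positivity) (abs_nonneg _) le_rfl

/-- The function found by the tester need not have mass 1, so it is normalised; if it vanishes, the
uniform distribution serves. -/
lemma exists_flatDist_near (hn : 1 ≤ n) {f : Fin n → ℝ} (hf : ∀ a, 0 ≤ f a)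
    (hI : I.IsFlatOn f) : ∃ r, IsFlatDist k r ∧ ∑ a, |f a - r a| = |∑ a, f a - 1| := by
  have hn' : (0 : ℝ) < n := by exact_mod_cast hn
  have hF0 : 0 ≤ ∑ a, f a := Finset.sum_nonneg fun a _ => hf a
  rcases hF0.eq_or_lt with h0 | hpos
  · have hfz : ∀ a, f a = 0 := fun a =>
      (Finset.sum_eq_zero_iff_of_nonneg fun a _ => hf a).mp h0.symm a (Finset.mem_univ a)
    refine ⟨fun _ => 1 / n, ⟨⟨fun _ => by positivity, ?_⟩, I, fun _ _ _ _ _ => rfl⟩, ?_⟩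
    · simp
      field_simp
    · simp [hfz]
      field_simp
  · refine ⟨fun a => f a / ∑ b, f b, ⟨⟨fun a => div_nonneg (hf a) hF0, ?_⟩, I,
      fun i a ha b hb => by simp only [hI i a ha b hb]⟩, ?_⟩
    · rw [← Finset.sum_div, div_self hpos.ne']
    · have : ∀ a, |f a - f a / ∑ b, f b| = f a * (|∑ b, f b - 1| / ∑ b, f b) := fun a => by
        have h1 : f a - f a / ∑ b, f b = f a * ((∑ b, f b - 1) / ∑ b, f b) := by
          field_simp
        rw [h1, abs_mul, abs_div, abs_of_nonneg (hf a), abs_of_pos hpos]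
      simp_rw [this]
      rw [← Finset.sum_mul]
      field_simp

/-- If the sample represents `p` well, then a segmentation that passes the tests yields a mixture
that is close to `p`. -/
lemma exists_mixture_near (hn : 1 ≤ n) (hk : 1 ≤ k) (hε : 0 < ε) (hε2 : ε ≤ 2)
    (hq : q ∈ stdSimplex ℝ (Fin n)) (hp : p ∈ stdSimplex ℝ (Fin n))
    (hα : α ∈ Set.Icc (0 : ℝ) 1) {f g : Fin n → ℝ} (hf : ∀ a, 0 ≤ f a) (hI : I.IsFlatOn f)
    (hg : ∑ a, g a = 1)
    (hgp : coarseDist (refinedDivision I q (ε / 14 / 4)) g p ≤ ε / 14)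
    (hgf : coarseDist (refinedDivision I q (ε / 14 / 4)) g (mixture α q f) < 2 * (ε / 14))
    (h : ∀ D ∈ refinedDivision I q (ε / 14 / 4), 2 ≤ D.card →
      ε / 14 / numCells n k ε ≤ ∑ a ∈ D, p a →
      ∑ a ∈ D, (p a - (∑ b ∈ D, p b) / D.card) ^ 2 ≤
        9 * (ε / 14) ^ 2 * (∑ a ∈ D, p a) ^ 2 / D.card) :
    ∃ r, IsFlatDist k r ∧ l1Dist p (mixture α q r) < ε := by
  have hη : 0 < ε / 14 / 4 := by positivity
  obtain ⟨r, hr, hfr⟩ := exists_flatDist_near hn hf hI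
  refine ⟨r, hr, ?_⟩
  have h1 := sum_abs_sub_average_refinedDivision_le hn hk hε hq hp h
  have h2 : ∑ D ∈ refinedDivision I q (ε / 14 / 4), ∑ a ∈ D,
      |mixture α q f a - (∑ b ∈ D, mixture α q f b) / D.card| ≤ 3 * (ε / 14 / 4) := by
    refine (Finset.sum_le_sum fun D hD => ?_).trans
      (sum_abs_sub_average_bucket_le (I := I) hn hη (by linarith) hq)
    obtain ⟨i, j, hDi, -⟩ := exists_subset_of_mem_refinedDivision hD
    exact sum_abs_sub_average_mixture_le hα fun a ha b hb => hI i a (hDi ha) b (hDi hb)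
  have h3 := l1Dist_le_of_refinedDivision (I := I) hη hq p (mixture α q f)
  have h4 := coarseDist_triangle (refinedDivision I q (ε / 14 / 4)) p g (mixture α q f)
  rw [coarseDist_comm _ p g] at h4
  -- As `g` and `q` have mass 1, the total masses of `g` and the mixture differ by α(∑f - 1), and
  -- the coarse distance controls this.
  have h5 : α * |∑ a, f a - 1| < 2 * (ε / 14) := by
    refine lt_of_le_of_lt ?_ hgf
    have h6 : ∑ D ∈ refinedDivision I q (ε / 14 / 4),
        ((∑ a ∈ D, g a) - ∑ a ∈ D, mixture α q f a) = -(α * (∑ a, f a - 1)) := by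
      rw [Finset.sum_sub_distrib, sum_refinedDivision hη hq, sum_refinedDivision hη hq, hg]
      simp only [mixture, Finset.sum_add_distrib, ← Finset.mul_sum, hq.2]
      ring
    calc α * |∑ a, f a - 1| = |-(α * (∑ a, f a - 1))| := by
          rw [abs_neg, abs_mul, abs_of_nonneg hα.1]
      _ ≤ _ := by
          rw [← h6]
          exact Finset.abs_sum_le_sum_abs _ _
  have h7 : l1Dist p (mixture α q r) ≤ l1Dist p (mixture α q f) + α * |∑ a, f a - 1| := by
    unfold l1Dist
    rw [← hfr, Finset.mul_sum, ← Finset.sum_add_distrib]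
    refine Finset.sum_le_sum fun a _ => (abs_sub_le _ (mixture α q f a) _).trans ?_
    gcongr
    have : mixture α q f a - mixture α q r a = α * (f a - r a) := by
      unfold mixture; ring
    rw [this, abs_mul, abs_of_nonneg hα.1]
  -- In units of ε' the budget is 7 for p, 1 + 2 for the coarse distances, 3/4 for q and 2 for the
  -- normalisation: less than 14.
  linarith

/-- A set that is heavy and far from uniform is unlikely to pass the uniformity test. -/
lemma prob_passes_of_far_from_uniform_le (hn : 1 ≤ n) (hk : 1 ≤ k) (hε : 0 < ε) (hε2 : ε ≤ 2)
    (hp : p ∈ stdSimplex ℝ (Fin n)) {D : Finset (Fin n)} (hD2 : 2 ≤ D.card)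
    (htn : numCells n k ε < n) (hdt : (D.card : ℝ) * numCells n k ε ≤ 2 * n)
    (hP : ε / 14 / numCells n k ε ≤ ∑ a ∈ D, p a)
    (hV : 9 * (ε / 14) ^ 2 * (∑ a ∈ D, p a) ^ 2 / D.card ≤
      ∑ a ∈ D, (p a - (∑ b ∈ D, p b) / D.card) ^ 2) :
    prob p (fun x : Fin (numBatches 10 n ε * batchSize (10 ^ 9) n k ε) → Fin n =>
        ε / 14 * ((numBatches 10 n ε * batchSize (10 ^ 9) n k ε : ℕ) : ℝ) /
          (4 * numCells n k ε) ≤ (countIn x D : ℝ) → ¬ LooksNonuniform (ε / 14) x D) ≤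
      2 * Real.exp (-(10 * Real.log (4 * n / ε))) := by
  have ht : (1 : ℝ) ≤ numCells n k ε := by exact_mod_cast numCells_pos hk
  have hs := numSamples_pos hn hk hε hε2
  have hP0 : 0 < ∑ a ∈ D, p a := lt_of_lt_of_le (by positivity) hP
  have hP8 : ε / 14 / (8 * numCells n k ε) ≤ ∑ a ∈ D, p a := by
    refine le_trans ?_ hP
    gcongr
    linarith
  -- With a = ε's/t, a quarter of `a` is exactly the count from which the tester examines a set.
  have h1 := prob_countIn_lt (s := numBatches 10 n ε * batchSize (10 ^ 9) n k ε) hp D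
    (a := ε / 14 * ((numBatches 10 n ε * batchSize (10 ^ 9) n k ε : ℕ) : ℝ) / numCells n k ε)
    (by positivity) (by
      calc _ = ((numBatches 10 n ε * batchSize (10 ^ 9) n k ε : ℕ) : ℝ) *
            (ε / 14 / numCells n k ε) := by ring
        _ ≤ _ := by gcongr)
  have h2 := h1.trans (exp_threshold_le hn hk hε hε2 htn (by
    gcongr
    linarith))
  have h3 := (prob_not_looksNonuniform_le (R := numBatches 10 n ε) hp
    (prob_estimate_lt_of_far_from_uniform hp (by positivity) (by linarith) hD2 hP0
      (two_le_batchSize hn hk hε hε2) (le_batchSize_mul hk hε (Nat.cast_nonneg _) hdt hP8)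
      hV)).trans (one_third_pow_le n ε)
  refine (prob_mono hp fun x hx => ?_).trans ((prob_or_le hp _ _).trans
    ((add_le_add h2 h3).trans (le_of_eq (two_mul _).symm)))
  rcases lt_or_ge (countIn x D : ℝ) (ε / 14 *
    ((numBatches 10 n ε * batchSize (10 ^ 9) n k ε : ℕ) : ℝ) / numCells n k ε / 4) with h | h
  · exact Or.inl h
  · refine Or.inr (hx (le_trans (le_of_eq ?_) h))
    ring

/-- The tester rejects distributions that are far from all mixtures. -/
lemma soundness (hn : 1 ≤ n) (hk : 1 ≤ k) (hε : 0 < ε) (hε2 : ε ≤ 2)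
    (hq : q ∈ stdSimplex ℝ (Fin n)) (hp : p ∈ stdSimplex ℝ (Fin n))
    (hfar : IsFarFromMixtures k ε q p) :
    2 / 3 ≤ prob p (fun x =>
      ¬ Accepts k ε q (numBatches 10 n ε) (batchSize (10 ^ 9) n k ε) x) := by
  have hη : 0 < ε / 14 / 4 := by positivity
  have hs : 0 < numBatches 10 n ε * batchSize (10 ^ 9) n k ε := by
    exact_mod_cast numSamples_pos hn hk hε hε2
  -- Badness depends neither on the samples nor on a segmentation, so catching all bad runs deals
  -- with every segmentation at once.
  let Bad : Finset (Fin n) → Prop := fun D => 2 ≤ D.card ∧ numCells n k ε < n ∧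
    (D.card : ℝ) * numCells n k ε ≤ 2 * n ∧ ε / 14 / numCells n k ε ≤ ∑ a ∈ D, p a ∧
    9 * (ε / 14) ^ 2 * (∑ a ∈ D, p a) ^ 2 / D.card ≤
      ∑ a ∈ D, (p a - (∑ b ∈ D, p b) / D.card) ^ 2
  have hfail := prob_exists_le hp
    (fun (ab : Fin n × Fin n)
      (x : Fin (numBatches 10 n ε * batchSize (10 ^ 9) n k ε) → Fin n) =>
      Bad (run q (ε / 14 / 4) ab) ∧
      (ε / 14 * ((numBatches 10 n ε * batchSize (10 ^ 9) n k ε : ℕ) : ℝ) /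
          (4 * numCells n k ε) ≤ (countIn x (run q (ε / 14 / 4) ab) : ℝ) →
        ¬ LooksNonuniform (ε / 14) x (run q (ε / 14 / 4) ab)))
    (b := 2 * Real.exp (-(10 * Real.log (4 * n / ε)))) fun ab => by
      by_cases h : Bad (run q (ε / 14 / 4) ab)
      · refine (prob_mono hp fun x hx => hx.2).trans ?_
        obtain ⟨b1, b2, b3, b4, b5⟩ := h
        exact prob_passes_of_far_from_uniform_le hn hk hε hε2 hp b1 b2 b3 b4 b5
      · simp only [h, false_and]
        simp only [prob, if_false, expect_const hp]
        positivity
  have hcoarse := prob_lt_coarseDist hk hε hε2 hq hp hn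
  have hexp := exp_neg_log_le hn hε hε2
  have hn1 : (1 : ℝ) ≤ (n : ℝ) ^ 2 := one_le_pow₀ (by exact_mod_cast hn)
  have hbound : prob p (Accepts k ε q (numBatches 10 n ε) (batchSize (10 ^ 9) n k ε)) ≤
      1 / 3 := by
    refine (prob_mono hp ?_).trans ((prob_or_le hp _ _).trans
      ((add_le_add hfail hcoarse).trans ?_))
    · rintro x ⟨I, hunif, α, hα, f, hf, hI, hdist⟩
      by_contra hcon
      rw [not_or] at hcon
      obtain ⟨hc1, hc2⟩ := hcon
      push Not at hc2
      have hα' : α ∈ Set.Icc (0 : ℝ) 1 := by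
        rcases hα with rfl | ⟨h1, i, rfl⟩
        · simp
        · exact ⟨by positivity, h1⟩
      obtain ⟨r, hr, hlt⟩ := exists_mixture_near hn hk hε hε2 hq hp hα' hf hI
        (sum_empirical_univ hs x) (hc2 I) hdist fun D hD hD2 hP => by
          by_contra hV
          obtain ⟨htn, hdt⟩ := card_le_of_mem_refinedDivision hk hD hD2
          obtain ⟨ab, rfl⟩ := exists_eq_run hη hD (Finset.card_pos.mp (by omega))
          exact hc1 ⟨ab, ⟨hD2, htn, hdt, hP, (not_le.mp hV).le⟩, hunif _ hD⟩
      exact absurd (hfar r hr α hα') (not_le.mpr hlt)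
    · rw [Fintype.card_prod, Fintype.card_fin, Nat.cast_mul, ← sq]
      have : 1 * Real.exp (-(10 * Real.log (4 * n / ε))) ≤
        (n : ℝ) ^ 2 * Real.exp (-(10 * Real.log (4 * n / ε))) := by gcongr
      linarith
  rw [prob_not hp]
  linarith

end Soundness

end KFlat

end

theorem mainTheorem4 :
    ∃ (C₁ C₂ C : ℝ) (c : ℕ), 0 < C₁ ∧ 0 < C₂ ∧ 0 < C ∧
      ∀ (n k : ℕ) (ε : ℝ) (q : Fin n → ℝ), 1 ≤ k → 0 < ε → ε ≤ 2 →
        q ∈ stdSimplex ℝ (Fin n) →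
        (((KFlat.numBatches C₁ n ε * KFlat.batchSize C₂ n k ε : ℕ) : ℝ) ≤
          C * (√((n : ℝ) * k) / ε ^ (3.5 : ℝ)) * Real.log (4 * n / ε) ^ c) ∧
        KFlat.IsFlatNoiseIdentityTester k ε q
          (KFlat.numBatches C₁ n ε * KFlat.batchSize C₂ n k ε)
          (KFlat.Accepts k ε q (KFlat.numBatches C₁ n ε) (KFlat.batchSize C₂ n k ε)) := by
  refine ⟨10, 10 ^ 9, 10 ^ 12, 2, by norm_num, by norm_num, by norm_num, ?_⟩
  intro n k ε q hk hε hε2 hq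
  -- There is no distribution on the empty set.
  have hn : 1 ≤ n := by
    rcases Nat.eq_zero_or_pos n with rfl | h
    · simpa using hq.2
    · exact h
  refine ⟨KFlat.numSamples_le hn hk hε hε2, fun p hp => ⟨fun h => ?_, fun h => ?_⟩⟩
  · rw [KFlat.sampleProb_eq_prob]
    exact KFlat.completeness hn hk hε hε2 hq h
  · rw [KFlat.sampleProb_eq_prob]
    exact KFlat.soundness hn hk hε hε2 hq hp h
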